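/- Let $V$ be a simple Euclidean Jordan algebra of dimension $n$ and rank $r$, with unit $e$, trace $\mathrm{tr}$, determinant $\det$, inner product $(x,y)=\mathrm{tr}(xy)$, quadratic representation $P(x)y=2x(xy)-x^2y$ and Lebesgue measure $dx$ associated with the inner product. Let $\Omega$ be the open cone of squares (the interior of $\{x^2 : x\in V\}$), $z^{1/2}\in\Omega$ the square root of $z\in\Omega$, $]-e,e[\,=\{v\in V : e\pm v\in\Omega\}$, and let $T_\Omega=V+i\Omega\subset \mathbb V=V\otimes\mathbb C$. For $z\in\Omega$ and $v\in\,]-e,e[$ put $$\iota(z,v)=\Big(\tfrac12\big(z-P(z^{1/2})v\big),\ \tfrac12\big(z+P(z^{1/2})v\big)\Big).$$ For $k\in\mathbb N$ and $s,t\in\mathbb C$ let $c^{(k)}_{s,t}$ be the polynomial on $V\times V$ which on $\Omega\times\Omega$ is given by $$c^{(k)}_{s,t}(x,y)=(\det x)^{-s}(\det y)^{-t}\,\det\Big(\frac{\partial}{\partial x}-\frac{\partial}{\partial y}\Big)^k\Big((\det x)^{s+k}(\det y)^{t+k}\Big).$$ For $\lambda,\mu\in\mathbb C$ the Rankin–Cohen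 bracket maps a holomorphic function $F$ on $T_\Omega\times T_\Omega$ to the function $$B^{(k)}_{\lambda,\mu}F(z)=\Big(c^{(k)}_{\lambda-\frac nr,\,\mu-\frac nr}\Big(\frac{\partial}{\partial z},\frac{\partial}{\partial w}\Big)F\Big)(z,z),\qquad z\in T_\Omega .$$ Let $\mathcal L g(z)=\int_\Omega g(\xi)e^{i(z,\xi)}\,d\xi$ for $g\in C_c^\infty(\Omega)$, $z\in T_\Omega$, let $\mathcal L_2f(z,w)=\iint_{\Omega\times\Omega}f(\xi,\zeta)e^{i((z,\xi)+(w,\zeta))}\,d\xi\,d\zeta$ for $f\in C_c^\infty(\Omega\times\Omega)$, $z,w\in T_\Omega$, and set $\widehat B^{(k)}_{\lambda,\mu}=\mathcal L^{-1}\circ B^{(k)}_{\lambda,\mu}\circ\mathcal L_2$. Let $$\mathcal J f(\xi)=2^{-n}(\det\xi)^{n/r}\int_{]-e,e[}f(\iota(\xi,v))\,dv,\qquad \xi\in\Omega .$$ **Theorem.** Let $k\in\mathbb N$ and $\lambda,\mu\in\mathbb C$. The operator $\widehat B^{(k)}_{\lambda,\mu}$ is well defined on $C_c^\infty(\Omega\times\Omega)$,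 maps it into $C_c^\infty(\Omega)$, and $$\widehat B^{(k)}_{\lambda,\mu}=i^{rk}\,\mathcal J\circ c^{(k)}_{\lambda-\frac nr,\,\mu-\frac nr},$$ where $c^{(k)}_{\lambda-\frac nr,\mu-\frac nr}$ stands for multiplication by that polynomial. Here "well defined" means that for every $f\in C_c^\infty(\Omega\times\Omega)$ the function $B^{(k)}_{\lambda,\mu}\mathcal L_2f$ on $T_\Omega$ is the Laplace transform of the function $\widehat B^{(k)}_{\lambda,\mu}f\in C_c^\infty(\Omega)$, and every function $g$ on $\Omega$ whose Laplace integral converges absolutely on $T_\Omega$ and equals $B^{(k)}_{\lambda,\mu}\mathcal L_2f$ there coincides with $\widehat B^{(k)}_{\lambda,\mu}f$ almost everywhere on $\Omega$. -/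

import Mathlib

open MeasureTheory TopologicalSpace
open scoped TensorProduct ContDiff Distributions RealInnerProductSpace

noncomputable section

namespace RankinCohen

/-! ### Rank, trace and determinant of a Jordan algebra -/

section JordanAlgebra

variable (V : Type*) [NormedAddCommGroup V] [InnerProductSpace ℝ V] [FiniteDimensional ℝ V]
  [CommMagma V] [One V]

/-- The dimension `n` of `V`. -/
abbrev dim : ℕ := Module.finrank ℝ V

variable {V} in
/-- The powers `x⁰ = e`, `xᵐ⁺¹ = x xᵐ`. -/
def jpow (x : V) : ℕ → V
  | 0 => 1
  | m + 1 => x * jpow x m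

/-- The rank `r` of `V`: the largest degree of the minimal polynomial of an element `x`, that is,
the largest dimension of a subalgebra `ℝ[x] = span {e, x, x², …}`. -/
def rank : ℕ := ⨆ x : V, Module.finrank ℝ (Submodule.span ℝ (Set.range (jpow x)))

variable {V} in
/-- The coordinates of `x` in an orthonormal basis of `V` (the standard one chosen by Mathlib).
Polynomial functions on `V` are written as polynomials in these coordinates. -/
def coord (x : V) (j : Fin (dim V)) : ℝ := ⟪stdOrthonormalBasis ℝ V j, x⟫

/-- `q` is the generic minimal polynomial of `V`: monic of degree `r` in one variable, with
coefficients in the polynomial functions on `V`, and every `x` is a root of `q(x)`. There is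
exactly one such polynomial; at a regular `x` it is the minimal polynomial of `x`. -/
def IsGenericMinPoly (q : Polynomial (MvPolynomial (Fin (dim V)) ℝ)) : Prop :=
  q.Monic ∧ q.natDegree = rank V ∧
    ∀ x : V, ∑ j ∈ Finset.range (rank V + 1),
      MvPolynomial.eval (coord x) (q.coeff j) • jpow x j = 0

open Classical in
/-- The generic minimal polynomial `Tʳ - a₁(x) Tʳ⁻¹ + ⋯ + (-1)ʳ aᵣ(x)` of `V`. -/
def genericMinPoly : Polynomial (MvPolynomial (Fin (dim V)) ℝ) :=
  if h : ∃ q, IsGenericMinPoly V q then h.choose else 0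

/-- The determinant of `V`, `det = aᵣ`, as a polynomial in the coordinates. -/
def detPoly : MvPolynomial (Fin (dim V)) ℝ := (-1) ^ rank V * (genericMinPoly V).coeff 0

variable {V}

/-- The determinant function of `V`. -/
def det (x : V) : ℝ := MvPolynomial.eval (coord x) (detPoly V)

/-- The trace function of `V`, `tr = a₁`. -/
def tr (x : V) : ℝ := MvPolynomial.eval (coord x) (-(genericMinPoly V).coeff (rank V - 1))

end JordanAlgebra

/-- `V` is a simple Euclidean Jordan algebra with unit `e = 1`, whose inner product is
`(x, y) = tr (x y)`. Commutativity of the product is part of `CommMagma`, the Jordan identity is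
`IsCommJordan`. -/
class IsSimpleEuclideanJordanAlgebra (V : Type*) [NormedAddCommGroup V] [InnerProductSpace ℝ V]
    [FiniteDimensional ℝ V] [CommMagma V] [One V] : Prop extends IsCommJordan V, Nontrivial V where
  mul_add : ∀ x y z : V, x * (y + z) = x * y + x * z
  mul_smul : ∀ (a : ℝ) (x y : V), x * (a • y) = a • (x * y)
  one_mul : ∀ x : V, 1 * x = x
  /-- Euclidean: multiplications are symmetric for the inner product. -/
  inner_mul : ∀ x y z : V, ⟪x * y, z⟫ = ⟪y, x * z⟫
  /-- Simple: there is no non-trivial ideal. -/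
  simple : ∀ I : Submodule ℝ V, (∀ x : V, ∀ y ∈ I, x * y ∈ I) → I = ⊥ ∨ I = ⊤
  /-- Normalization of the inner product. -/
  inner_eq_tr : ∀ x y : V, ⟪x, y⟫ = tr (x * y)

/-! ### The symmetric cone and polar-type coordinates -/

section Cone

variable (V : Type*) [NormedAddCommGroup V] [InnerProductSpace ℝ V] [FiniteDimensional ℝ V]
  [CommMagma V] [One V]

/-- The open cone of squares `Ω`: the interior of the set of squares. -/
def cone : Opens V := ⟨interior (Set.range fun x : V => x * x), isOpen_interior⟩

/-- The product `Ω × Ω`, as an open subset of `V × V`. -/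
def cone₂ : Opens (V × V) :=
  ⟨(cone V : Set V) ×ˢ (cone V : Set V), (cone V).isOpen.prod (cone V).isOpen⟩

/-- The interval `]-e, e[`. -/
def interval : Set V := {v | 1 + v ∈ cone V ∧ 1 - v ∈ cone V}

variable {V}

/-- The quadratic representation `P(x) = 2 L(x)² - L(x²)`. -/
def quadRep (x y : V) : V := (2 : ℝ) • (x * (x * y)) - (x * x) * y

/-- The square root of `z ∈ Ω`: the element of `Ω` whose square is `z`. -/
def sqrt (z : V) : V := Function.invFunOn (fun w : V => w * w) (cone V) z

/-- The coordinates `ι(z, v) = ((z - P(z^{1/2}) v) / 2, (z + P(z^{1/2}) v) / 2)` on `Ω × Ω`. -/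
def iota (z v : V) : V × V :=
  ((1 / 2 : ℝ) • (z - quadRep (sqrt z) v), (1 / 2 : ℝ) • (z + quadRep (sqrt z) v))

variable [MeasurableSpace V] [BorelSpace V]

/-- The averaging operator
`𝒥 f (ξ) = 2⁻ⁿ (det ξ)^{n/r} ∫_{]-e, e[} f (ι(ξ, v)) dv` for `ξ ∈ Ω`
(a function on `Ω` is extended by zero outside `Ω`). -/
def averaging (f : V × V → ℂ) : V → ℂ :=
  (cone V : Set V).indicator fun ξ =>
    (((2 : ℝ) ^ dim V)⁻¹ * det ξ ^ ((dim V : ℝ) / (rank V : ℝ)) : ℝ) *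
      ∫ v in interval V, f (iota ξ v)

end Cone

/-! ### Constant coefficient differential operators -/

section DiffOp

variable (𝕜 : Type*) [NontriviallyNormedField 𝕜] [NormedSpace 𝕜 ℂ]
  {E : Type*} [AddCommGroup E] [Module 𝕜 E] {σ : Type*} [Fintype σ]

/-- The iterated partial derivative `∏ⱼ ∂_{v j}^{m j} F`, where `∂_v` is the derivative in the
direction `v` over `𝕜`. (The order of the factors is irrelevant for the smooth or holomorphic
functions `F` to which this is applied.) -/
def iterPartial (v : σ → E) (m : σ →₀ ℕ) (F : E → ℂ) : E → ℂ :=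
  (Finset.univ : Finset σ).toList.foldr
    (fun j G => (fun (H : E → ℂ) (z : E) => lineDeriv 𝕜 H z (v j))^[m j] G) F

/-- The differential operator `p(∂) F` obtained by substituting `∂_{v j}` for the `j`-th variable
of the polynomial `p`. -/
def diffOp (v : σ → E) (p : MvPolynomial σ ℂ) (F : E → ℂ) (z : E) : ℂ :=
  ∑ m ∈ p.support, p.coeff m * iterPartial 𝕜 v m F z

end DiffOp

/-! ### The polynomials `c^{(k)}_{s,t}` -/

section Polynomials

variable (V : Type*) [NormedAddCommGroup V] [InnerProductSpace ℝ V] [FiniteDimensional ℝ V]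

/-- Index set of the coordinates `(x₁, …, xₙ, y₁, …, yₙ)` on `V × V`. -/
abbrev Idx : Type := Fin (dim V) ⊕ Fin (dim V)

variable {V} in
/-- The value at `(x, y) ∈ V × V` of a polynomial in the coordinates of `x` and `y`. -/
def evalPoly (p : MvPolynomial (Idx V) ℂ) (q : V × V) : ℂ :=
  MvPolynomial.eval (Sum.elim (fun j => (coord q.1 j : ℂ)) (fun j => (coord q.2 j : ℂ))) p

/-- The orthonormal directions `∂/∂x₁, …, ∂/∂xₙ, ∂/∂y₁, …, ∂/∂yₙ` on `V × V`. -/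
def realDir : Idx V → V × V :=
  Sum.elim (fun j => (stdOrthonormalBasis ℝ V j, 0)) (fun j => (0, stdOrthonormalBasis ℝ V j))

variable [CommMagma V] [One V]

/-- The polynomial `det (x - y)` on `V × V`. -/
def detSubPoly : MvPolynomial (Idx V) ℂ :=
  MvPolynomial.aeval
    (fun j => (MvPolynomial.X (Sum.inl j) - MvPolynomial.X (Sum.inr j) : MvPolynomial (Idx V) ℂ))
    (detPoly V)

variable {V} in
/-- The function
`(det x)^{-s} (det y)^{-t} det (∂/∂x - ∂/∂y)^k ((det x)^{s+k} (det y)^{t+k})` on `Ω × Ω`. -/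
def cFun (k : ℕ) (s t : ℂ) (q : V × V) : ℂ :=
  (det q.1 : ℂ) ^ (-s) * (det q.2 : ℂ) ^ (-t) *
    diffOp ℝ (realDir V) (detSubPoly V ^ k)
      (fun u : V × V => (det u.1 : ℂ) ^ (s + k) * (det u.2 : ℂ) ^ (t + k)) q

open Classical in
/-- The polynomial `c^{(k)}_{s,t}` on `V × V`: the unique polynomial that coincides on `Ω × Ω` with
the function `cFun k s t`. -/
def cPoly (k : ℕ) (s t : ℂ) : MvPolynomial (Idx V) ℂ :=
  if h : ∃ p : MvPolynomial (Idx V) ℂ, ∀ x ∈ cone V, ∀ y ∈ cone V,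
      evalPoly p (x, y) = cFun k s t (x, y)
  then h.choose else 0

end Polynomials

/-! ### The tube domain, the brackets and the Laplace transforms -/

section Tube

variable (V : Type*) [NormedAddCommGroup V] [InnerProductSpace ℝ V]

variable {V} in
/-- The imaginary part `V ⊗ ℂ → V`, `x + i y ↦ y`. -/
def imPart : ℂ ⊗[ℝ] V →ₗ[ℝ] V :=
  TensorProduct.lift ((LinearMap.lsmul ℝ V).comp Complex.imLm)

variable {V} in
@[simp] theorem imPart_tmul (a : ℂ) (x : V) : imPart (a ⊗ₜ[ℝ] x) = a.im • x := rfl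

variable {V} in
/-- The complex linear extension `z ↦ (z, ξ)` to `V ⊗ ℂ` of the inner product with `ξ`. -/
def pairing (ξ : V) : ℂ ⊗[ℝ] V →ₗ[ℝ] ℂ :=
  TensorProduct.lift ((LinearMap.lsmul ℝ ℂ).comp (innerₗ V ξ)).flip

variable {V} in
@[simp] theorem pairing_tmul (ξ : V) (a : ℂ) (x : V) :
    pairing ξ (a ⊗ₜ[ℝ] x) = ⟪ξ, x⟫ • a := rfl

variable [FiniteDimensional ℝ V] [CommMagma V] [One V]

/-- The tube domain `T_Ω = V + i Ω`. -/
def tube : Set (ℂ ⊗[ℝ] V) := {z | imPart z ∈ cone V}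

/-- The complex directions `∂/∂z₁, …, ∂/∂zₙ, ∂/∂w₁, …, ∂/∂wₙ`. -/
def complexDir : Idx V → (ℂ ⊗[ℝ] V) × (ℂ ⊗[ℝ] V) :=
  Sum.elim (fun j => (1 ⊗ₜ[ℝ] stdOrthonormalBasis ℝ V j, 0))
    (fun j => (0, 1 ⊗ₜ[ℝ] stdOrthonormalBasis ℝ V j))

variable {V}

/-- The `k`-th generalized Rankin-Cohen bracket
`B^{(k)}_{λ,μ} = res ∘ c^{(k)}_{λ-n/r, μ-n/r} (∂/∂z, ∂/∂w)`,
where `res` is the restriction to the diagonal. -/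
def bracket (k : ℕ) (lam mu : ℂ) (F : (ℂ ⊗[ℝ] V) × (ℂ ⊗[ℝ] V) → ℂ) (z : ℂ ⊗[ℝ] V) : ℂ :=
  diffOp ℂ (complexDir V)
    (cPoly V k (lam - (dim V : ℂ) / (rank V : ℂ)) (mu - (dim V : ℂ) / (rank V : ℂ))) F (z, z)

variable [MeasurableSpace V] [BorelSpace V]

/-- The Laplace transform `ℒ g (z) = ∫_Ω g(ξ) e^{i (z, ξ)} dξ`. -/
def laplace (g : V → ℂ) (z : ℂ ⊗[ℝ] V) : ℂ :=
  ∫ ξ in (cone V : Set V), g ξ * Complex.exp (Complex.I * pairing ξ z)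

/-- The Laplace transform `ℒ₂ f (z, w) = ∬_{Ω × Ω} f(ξ, ζ) e^{i ((z, ξ) + (w, ζ))} dξ dζ`. -/
def laplace₂ (f : V × V → ℂ) (p : (ℂ ⊗[ℝ] V) × (ℂ ⊗[ℝ] V)) : ℂ :=
  ∫ q in (cone₂ V : Set (V × V)),
    f q * Complex.exp (Complex.I * (pairing q.1 p.1 + pairing q.2 p.2))

open Classical in
/-- The inverse Laplace transform: `ℒ⁻¹ F` is the function in `C_c^∞(Ω)` whose Laplace transform
is `F` on `T_Ω`, if there is one. -/
def laplaceInv (F : ℂ ⊗[ℝ] V → ℂ) : V → ℂ :=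
  if h : ∃ g : 𝓓(cone V, ℂ), ∀ z ∈ tube V, laplace g z = F z then h.choose else 0

/-- The bracket in the `L²`-model, `B̂^{(k)}_{λ,μ} = ℒ⁻¹ ∘ B^{(k)}_{λ,μ} ∘ ℒ₂`. -/
def hatBracket (k : ℕ) (lam mu : ℂ) (f : V × V → ℂ) : V → ℂ :=
  laplaceInv (bracket k lam mu (laplace₂ f))

end Tube

end RankinCohen

end

/-! Put h = i^{rk} c f. Under the integral sign, c(∂/∂z, ∂/∂w) multiplies the integrand of ℒ₂ f by
c(iξ, iζ). Since c is homogeneous of degree rk on Ω × Ω, this factor is i^{rk} c(ξ, ζ)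
(`diffOp_laplace₂`, `cPoly_homogeneous`, `HomogeneousOnCone.eval_I`). On the diagonal the
exponential depends only on ξ + ζ, so the bracket is the Laplace transform of the density ξ ↦ ∫ h(x,
ξ - x) dx of the image of h under addition (`laplace_pushSum`). This density is smooth, with compact
support in Ω because Ω + Ω ⊆ Ω. The substitution x = (ξ - P(ξ^{1/2}) v)/2 turns it into 𝒥 h
(`averaging_eq_pushSum`): the Jacobian is 2⁻ⁿ |Det P(ξ^{1/2})| = 2⁻ⁿ (det ξ)^{n/r}, and ι(ξ, v) can
lie in Ω × Ω only for v in ]-e, e[. Uniqueness is injectivity of the Fourier transform on the slice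
V + ie (`ae_eq_of_laplace_eq`).

The Jordan-theoretic input is derived from the axioms. The spectral theorem identifies Ω with the y
for which L(y) is positive definite (`mem_cone_iff`) and writes each such y as exp(L(x)) e. The
identity P(exp(tL(x)) z) = exp(tL(x)) P(z) exp(tL(x)) (`quadOp_flow`) shows that these exponentials
preserve Ω and that P(z^{1/2}) is one of them. Its determinant is found from Tr L(x) = (n/r) tr x, a
consequence of simplicity (`traceL_eq`), and from the eigenvalue formulas for tr and det at regular
elements, which are dense. -/

set_option linter.unusedSectionVars false

noncomputable section

namespace RankinCohen

/-! ### Multiplication operators -/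

section Multiplication

variable {V : Type*} [NormedAddCommGroup V] [InnerProductSpace ℝ V] [FiniteDimensional ℝ V]
  [CommMagma V] [One V] [IsSimpleEuclideanJordanAlgebra V]

/-- The multiplication operator `L(x) y = x y`, as a continuous bilinear map. -/
def lmul : V →L[ℝ] V →L[ℝ] V :=
  LinearMap.toContinuousLinearMap
    { toFun := fun x => LinearMap.toContinuousLinearMap
        { toFun := fun y => x * y
          map_add' := IsSimpleEuclideanJordanAlgebra.mul_add x
          map_smul' := fun a y => IsSimpleEuclideanJordanAlgebra.mul_smul a x y }
      map_add' := fun x y => by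
        ext z
        simp [mul_comm _ z, IsSimpleEuclideanJordanAlgebra.mul_add]
      map_smul' := fun a x => by
        ext z
        simp [mul_comm _ z, IsSimpleEuclideanJordanAlgebra.mul_smul] }

@[simp] theorem lmul_apply (x y : V) : lmul x y = x * y := rfl

theorem jadd (x y z : V) : x * (y + z) = x * y + x * z := IsSimpleEuclideanJordanAlgebra.mul_add x y z

theorem add_jmul (x y z : V) : (x + y) * z = x * z + y * z := by
  rw [mul_comm, jadd, mul_comm z, mul_comm z]

theorem jmul_smul (a : ℝ) (x y : V) : x * (a • y) = a • (x * y) :=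
  IsSimpleEuclideanJordanAlgebra.mul_smul a x y

theorem smul_jmul (a : ℝ) (x y : V) : (a • x) * y = a • (x * y) := by
  rw [mul_comm, jmul_smul, mul_comm]

theorem jone_mul (x : V) : 1 * x = x := IsSimpleEuclideanJordanAlgebra.one_mul x

theorem jmul_one (x : V) : x * 1 = x := by rw [mul_comm, jone_mul]

theorem jmul_zero (x : V) : x * 0 = 0 := (lmul x).map_zero

theorem zero_jmul (x : V) : 0 * x = 0 := by rw [mul_comm, jmul_zero]

theorem jmul_sub (x y z : V) : x * (y - z) = x * y - x * z := (lmul x).map_sub y z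

theorem jmul_sum {ι : Type*} (s : Finset ι) (x : V) (f : ι → V) :
    x * ∑ i ∈ s, f i = ∑ i ∈ s, x * f i := map_sum (lmul x) f s

theorem sum_jmul {ι : Type*} (s : Finset ι) (x : V) (f : ι → V) :
    (∑ i ∈ s, f i) * x = ∑ i ∈ s, f i * x := by
  simp only [mul_comm _ x, jmul_sum]

@[simp] theorem lmul_one : lmul (1 : V) = 1 := by
  ext x
  simp [jone_mul]

theorem inner_jmul (x y z : V) : ⟪x * y, z⟫ = ⟪y, x * z⟫ :=
  IsSimpleEuclideanJordanAlgebra.inner_mul x y z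

theorem lmul_isSymmetric (x : V) : ((lmul x : V →L[ℝ] V) : V →ₗ[ℝ] V).IsSymmetric :=
  fun y z => inner_jmul x y z

/-! ### Linearizations of the Jordan identity -/

omit [FiniteDimensional ℝ V] [CommMagma V] [One V] [IsSimpleEuclideanJordanAlgebra V] in
theorem mulop_apply (A B : V →L[ℝ] V) (x : V) : (A * B) x = A (B x) := rfl

omit [FiniteDimensional ℝ V] [CommMagma V] [One V] [IsSimpleEuclideanJordanAlgebra V] in
theorem oneop_apply (x : V) : (1 : V →L[ℝ] V) x = x := rfl

theorem lmul_commute_sq (x : V) : lmul x * lmul (x * x) = lmul (x * x) * lmul x := by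
  ext y
  have h := IsCommJordan.lmul_comm_rmul_rmul x y
  simp only [mulop_apply, lmul_apply]
  rw [mul_comm (x * x) y, ← h, mul_comm]

/-- The complete linearization of `[L(x), L(x²)] = 0`. -/
theorem lmul_linearized (a b c : V) :
    lmul a * lmul (b * c) + lmul b * lmul (c * a) + lmul c * lmul (a * b) =
      lmul (b * c) * lmul a + lmul (c * a) * lmul b + lmul (a * b) * lmul c := by
  have h1 := lmul_commute_sq (a + b + c)
  have h2 := lmul_commute_sq (a + b)
  have h3 := lmul_commute_sq (b + c)
  have h4 := lmul_commute_sq (a + c)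
  have h5 := lmul_commute_sq a
  have h6 := lmul_commute_sq b
  have h7 := lmul_commute_sq c
  simp only [jadd, add_jmul, map_add, mul_comm b a, mul_comm c a, mul_comm c b, mul_add, add_mul]
    at h1 h2 h3 h4 ⊢
  -- Inclusion–exclusion over a + b + c, the pairs and the single elements isolates the part linear
  -- in each variable. Each product such as bc occurs twice, hence the factor 2.
  have key : (2 : ℝ) • (lmul a * lmul (b * c) + lmul b * lmul (a * c) + lmul c * lmul (a * b)) =
      (2 : ℝ) • (lmul (b * c) * lmul a + lmul (a * c) * lmul b + lmul (a * b) * lmul c) := by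
    linear_combination (norm := module) h1 - h2 - h3 - h4 + h5 + h6 + h7
  exact smul_right_injective _ (two_ne_zero (α := ℝ)) key

/-- Evaluate the linearized identity for x, y, z at w and read the result as an operator identity in
z. -/
theorem lmul_triple (x y w : V) :
    lmul x * lmul w * lmul y + lmul y * lmul w * lmul x + lmul ((x * y) * w) =
      lmul (x * w) * lmul y + lmul (y * w) * lmul x + lmul (x * y) * lmul w := by
  ext z
  have h := congrArg (fun T : V →L[ℝ] V => T w) (lmul_linearized x y z)
  simp only [mulop_apply, lmul_apply, add_apply] at h ⊢
  rw [mul_comm w (y * z), mul_comm w (x * z), mul_comm (x * y * w) z, mul_comm (x * w),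
    mul_comm (y * w), mul_comm w z, mul_comm x z]
  exact h

/-- Exchanging y and w in `lmul_triple` and subtracting leaves the commutator [L(x), [L(y), L(w)]],
whose trace vanishes. -/
theorem lmul_assoc_sub (x y w : V) :
    lmul ((x * y) * w) - lmul ((x * w) * y) =
      lmul x * (lmul y * lmul w - lmul w * lmul y) -
        (lmul y * lmul w - lmul w * lmul y) * lmul x := by
  have h1 := lmul_triple x y w
  have h2 := lmul_triple x w y
  rw [mul_comm w y] at h2
  simp only [mul_sub, sub_mul, ← mul_assoc]
  linear_combination (norm := module) h1 - h2

/-! ### Powers -/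

/-- `lmul_triple` expresses L(xᵐ⁺²) through L(x), L(x²), L(xᵐ) and L(xᵐ⁺¹), so commutation with L(x)
propagates by strong induction. -/
theorem lmul_jpow_commute (x : V) (m : ℕ) : Commute (lmul x) (lmul (jpow x m)) := by
  induction m using Nat.strong_induction_on with
  | _ m ih =>
    match m with
    | 0 => simp [jpow]
    | 1 => simp [jpow, jmul_one]
    | m + 2 =>
      have h := lmul_triple x (jpow x m) x
      have h0 := ih m (by omega)
      have h1 : Commute (lmul x) (lmul (x * jpow x m)) := ih (m + 1) (by omega)
      have h2 : Commute (lmul x) (lmul (x * x)) := lmul_commute_sq x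
      have h3 : lmul (jpow x (m + 2)) = lmul (x * x) * lmul (jpow x m) +
          lmul (x * jpow x m) * lmul x + lmul (x * jpow x m) * lmul x -
          (lmul x * lmul x * lmul (jpow x m) + lmul (jpow x m) * lmul x * lmul x) := by
        rw [mul_comm (jpow x m) x, mul_comm (x * jpow x m) x] at h
        rw [eq_sub_iff_add_eq, ← h]
        simp only [jpow]
        abel
      rw [h3]
      have h4 := Commute.refl (lmul x)
      exact ((((h2.mul_right h0).add_right (h1.mul_right h4)).add_right (h1.mul_right h4))).sub_right
        (((h4.mul_right h4).mul_right h0).add_right ((h0.mul_right h4).mul_right h4))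

theorem lmul_pow_one (x : V) (m : ℕ) : (lmul x ^ m) 1 = jpow x m := by
  induction m with
  | zero => rfl
  | succ m ih => rw [pow_succ', mulop_apply, ih]; rfl

open Polynomial in
/-- The value `p(x)` of a real polynomial at `x`. -/
def peval (x : V) (p : ℝ[X]) : V := aeval (lmul x) p 1

open Polynomial in
theorem peval_eq_sum (x : V) (p : ℝ[X]) :
    peval x p = ∑ j ∈ Finset.range (p.natDegree + 1), p.coeff j • jpow x j := by
  simp only [peval, aeval_eq_sum_range, sum_apply, smul_apply, lmul_pow_one]

open Polynomial in
theorem lmul_peval_commute (x : V) (p : ℝ[X]) : Commute (lmul x) (lmul (peval x p)) := by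
  rw [peval_eq_sum, map_sum]
  refine Commute.sum_right _ _ _ fun j _ => ?_
  rw [map_smul]
  exact (lmul_jpow_commute x j).smul_right _

open Polynomial in
-- Power associativity: q(L(x)) commutes with L(p(x)), and evaluating both products at e gives the
-- two sides.
theorem peval_mul (x : V) (p q : ℝ[X]) : peval x (p * q) = peval x p * peval x q := by
  have h : Commute (aeval (lmul x) q) (lmul (peval x p)) := by
    induction q using Polynomial.induction_on' with
    | add a b ha hb => rw [map_add]; exact ha.add_left hb
    | monomial n a =>
      rw [aeval_monomial]
      exact (Algebra.commute_algebraMap_left a _).mul_left ((lmul_peval_commute x p).pow_left n)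
  rw [mul_comm p q, peval, map_mul]
  have h1 := congrArg (fun T : V →L[ℝ] V => T 1) h.eq
  simp only [mulop_apply, lmul_apply, jmul_one] at h1
  exact h1

theorem jmul_peval (x : V) (p : Polynomial ℝ) : x * peval x p = peval x (Polynomial.X * p) := by
  simp [peval]

end Multiplication

section Spectral

variable {V : Type*} [NormedAddCommGroup V] [InnerProductSpace ℝ V] [FiniteDimensional ℝ V]
  [CommMagma V] [One V] [IsSimpleEuclideanJordanAlgebra V]

/-! ### Spectral theorem -/

/-- `(c μ)` for `μ ∈ S` is a complete system of nonzero orthogonal idempotents. -/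
structure IsIdempotentSystem (S : Finset ℝ) (c : ℝ → V) : Prop where
  ne_zero : ∀ μ ∈ S, c μ ≠ 0
  idem : ∀ μ ∈ S, c μ * c μ = c μ
  orth : ∀ μ ∈ S, ∀ ν ∈ S, μ ≠ ν → c μ * c ν = 0
  sum_eq : ∑ μ ∈ S, c μ = 1

/-- The element `∑ f(μ) c_μ`. -/
def fcalc (S : Finset ℝ) (c : ℝ → V) (f : ℝ → ℝ) : V := ∑ μ ∈ S, f μ • c μ

namespace IsIdempotentSystem

variable {S : Finset ℝ} {c : ℝ → V} (h : IsIdempotentSystem S c)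
include h

theorem fcalc_mul_apply (f : ℝ → ℝ) {ν : ℝ} (hν : ν ∈ S) : fcalc S c f * c ν = f ν • c ν := by
  rw [fcalc, sum_jmul, Finset.sum_eq_single_of_mem ν hν]
  · rw [smul_jmul, h.idem ν hν]
  · intro μ hμ hne
    rw [smul_jmul, h.orth μ hμ ν hν hne, smul_zero]

theorem fcalc_mul (f g : ℝ → ℝ) : fcalc S c f * fcalc S c g = fcalc S c (fun μ => f μ * g μ) := by
  conv_lhs => rw [fcalc.eq_1 S c g, jmul_sum]
  refine Finset.sum_congr rfl fun μ hμ => ?_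
  rw [jmul_smul, h.fcalc_mul_apply f hμ, smul_smul, mul_comm]

theorem fcalc_one : fcalc S c (fun _ => 1) = 1 := by simp [fcalc, h.sum_eq]

theorem jpow_fcalc (f : ℝ → ℝ) (m : ℕ) : jpow (fcalc S c f) m = fcalc S c (fun μ => f μ ^ m) := by
  induction m with
  | zero => simp [jpow, h.fcalc_one]
  | succ m ih =>
    rw [jpow, ih, h.fcalc_mul]
    simp [pow_succ']

theorem eq_zero_of_fcalc_eq_zero {f : ℝ → ℝ} (hf : fcalc S c f = 0) {μ : ℝ} (hμ : μ ∈ S) :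
    f μ = 0 := by
  have := h.fcalc_mul_apply f hμ
  rw [hf, zero_jmul] at this
  exact (smul_eq_zero.1 this.symm).resolve_right (h.ne_zero μ hμ)

end IsIdempotentSystem

theorem fcalc_add (S : Finset ℝ) (c : ℝ → V) (f g : ℝ → ℝ) :
    fcalc S c (fun μ => f μ + g μ) = fcalc S c f + fcalc S c g := by
  simp [fcalc, add_smul, Finset.sum_add_distrib]

theorem fcalc_smul (S : Finset ℝ) (c : ℝ → V) (a : ℝ) (f : ℝ → ℝ) :
    fcalc S c (fun μ => a * f μ) = a • fcalc S c f := by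
  simp [fcalc, Finset.smul_sum, smul_smul]

open Polynomial in
-- L(x) is symmetric, so the product of T - μ over its distinct eigenvalues annihilates an
-- eigenbasis.
theorem exists_peval_nodal_eq_zero (x : V) :
    ∃ S : Finset ℝ, S.Nonempty ∧ aeval (lmul x) (Lagrange.nodal S id) = 0 := by
  classical
  have hs := lmul_isSymmetric x
  have : Nontrivial V := IsSimpleEuclideanJordanAlgebra.toNontrivial
  have : Nonempty (Fin (Module.finrank ℝ V)) := Fin.pos_iff_nonempty.1 Module.finrank_pos
  refine ⟨Finset.univ.image (hs.eigenvalues rfl), Finset.univ_nonempty.image _, ?_⟩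
  apply ContinuousLinearMap.coe_injective
  refine (hs.eigenvectorBasis rfl).toBasis.ext fun i => ?_
  set N := Lagrange.nodal (Finset.univ.image (hs.eigenvalues rfl)) id with hN
  have h1 : lmul x (hs.eigenvectorBasis rfl i) =
      hs.eigenvalues rfl i • hs.eigenvectorBasis rfl i := hs.apply_eigenvectorBasis rfl i
  have h2 : ∀ p : ℝ[X], aeval (lmul x) p (hs.eigenvectorBasis rfl i) =
      p.eval (hs.eigenvalues rfl i) • hs.eigenvectorBasis rfl i := by
    intro p
    induction p using Polynomial.induction_on with
    | C a => simp [Algebra.algebraMap_eq_smul_one]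
    | add p q hp hq => simp [hp, hq, add_smul]
    | monomial n a ih =>
      rw [pow_succ, ← mul_assoc, map_mul, mulop_apply, aeval_X, h1, map_smul, ih, eval_mul_X,
        smul_smul, mul_comm]
  simp only [OrthonormalBasis.coe_toBasis]
  have h3 := h2 N
  rw [hN, Lagrange.eval_nodal, Finset.prod_eq_zero (Finset.mem_image_of_mem _ (Finset.mem_univ i))
    (by simp), zero_smul] at h3
  exact h3

open Polynomial in
/-- The spectral theorem. -/
theorem exists_isIdempotentSystem (x : V) :
    ∃ (S : Finset ℝ) (c : ℝ → V), IsIdempotentSystem S c ∧ x = fcalc S c id := by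
  classical
  obtain ⟨S, hS, hN⟩ := exists_peval_nodal_eq_zero x
  -- The candidate idempotents are the Lagrange interpolation polynomials at the eigenvalues of
  -- L(x), evaluated at x.
  set c : ℝ → V := fun μ => peval x (Lagrange.basis S id μ) with hc
  have hinj : Set.InjOn (id : ℝ → ℝ) S := Function.injective_id.injOn
  have hsum : ∑ μ ∈ S, c μ = 1 := by
    have := congrArg (peval x) (Lagrange.sum_basis hinj hS)
    simpa [peval, hc, sum_apply] using this
  have hx : ∀ μ ∈ S, x * c μ = μ • c μ := by
    intro μ hμ
    have h0 : peval x (Lagrange.nodal S id) = 0 := by rw [peval, hN]; rfl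
    have h1 : (X - C μ) * Lagrange.basis S id μ =
        C (Lagrange.nodalWeight S id μ) * Lagrange.nodal S id := by
      rw [Lagrange.basis_eq_prod_sub_inv_mul_nodal_div hμ, ← Lagrange.nodal_erase_eq_nodal_div hμ,
        Lagrange.nodal_eq_mul_nodal_erase hμ]
      simp only [id]
      ring
    have h2 : peval x ((X - C μ) * Lagrange.basis S id μ) = 0 := by
      rw [h1, peval_mul, h0, jmul_zero]
    rw [sub_mul] at h2
    rw [jmul_peval]
    simp only [peval, map_sub, sub_apply, map_mul, aeval_C, mulop_apply,
      Algebra.algebraMap_eq_smul_one, smul_apply, sub_eq_zero] at h2 ⊢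
    simpa [hc, peval] using h2
  have hassoc : ∀ μ ν, x * (c μ * c ν) = (x * c μ) * c ν := by
    intro μ ν
    simp only [hc]
    rw [← peval_mul, jmul_peval, jmul_peval, ← peval_mul, mul_assoc]
  have horth : ∀ μ ∈ S, ∀ ν ∈ S, μ ≠ ν → c μ * c ν = 0 := by
    intro μ hμ ν hν hne
    have h1 := hassoc μ ν
    have h2 := hassoc ν μ
    rw [hx μ hμ, smul_jmul] at h1
    rw [hx ν hν, smul_jmul, mul_comm (c ν)] at h2
    have h3 : (μ - ν) • (c μ * c ν) = 0 := by rw [sub_smul, ← h1, ← h2, sub_self]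
    exact (smul_eq_zero.1 h3).resolve_left (sub_ne_zero.2 hne)
  have hidem : ∀ μ ∈ S, c μ * c μ = c μ := by
    intro μ hμ
    conv_rhs => rw [← jmul_one (c μ), ← hsum, jmul_sum]
    rw [Finset.sum_eq_single_of_mem μ hμ fun ν hν hne => horth μ hμ ν hν hne.symm]
  -- L(x) can have eigenvalues that are not spectral values of x; their idempotents vanish and are
  -- discarded.
  refine ⟨S.filter (fun μ => c μ ≠ 0), c, ⟨fun μ hμ => (Finset.mem_filter.1 hμ).2,
    fun μ hμ => hidem μ (Finset.mem_filter.1 hμ).1, fun μ hμ ν hν => horth μ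
    (Finset.mem_filter.1 hμ).1 ν (Finset.mem_filter.1 hν).1, ?_⟩, ?_⟩
  · rw [Finset.sum_filter_ne_zero, hsum]
  · rw [fcalc, Finset.sum_filter_of_ne]
    · conv_lhs => rw [← jmul_one x, ← hsum, jmul_sum]
      exact Finset.sum_congr rfl hx
    · intro μ _ h0 h1
      exact h0 (by rw [h1, smul_zero])

/-! ### The symmetric cone -/

/-- Peirce decomposition: 2L(c)³ - 3L(c)² + L(c) = 0 forces the eigenvalues 0, 1/2, 1. Below, A and
B are the projections of v to the eigenspaces for 1 and 1/2, so the form equals |A|² + |B|²/2. -/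
theorem inner_idempotent_nonneg {c : V} (hc : c * c = c) (v : V) : 0 ≤ ⟪c * v, v⟫ := by
  have h := lmul_triple c c c
  simp only [hc] at h
  have hs : ∀ u w : V, ⟪c * u, w⟫ = ⟪u, c * w⟫ := inner_jmul c
  have h3 : ∀ u : V, (2 : ℝ) • (c * (c * (c * u))) = (3 : ℝ) • (c * (c * u)) - c * u := by
    intro u
    have := congrArg (fun T : V →L[ℝ] V => T u) h
    simp only [add_apply, mulop_apply, lmul_apply] at this
    linear_combination (norm := module) this
  have h4 : ∀ u : V, c * (c * (c * u)) = (3 / 2 : ℝ) • (c * (c * u)) - (1 / 2 : ℝ) • (c * u) := by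
    intro u
    linear_combination (norm := module) (1 / 2 : ℝ) • h3 u
  set A : V := (2 : ℝ) • (c * (c * v)) - c * v with hA
  set B : V := (4 : ℝ) • (c * v - c * (c * v)) with hB
  have hAA : (2 : ℝ) • (c * (c * A)) - c * A = A := by
    simp only [hA, jmul_sub, jmul_smul, h4]
    module
  have hBB : (4 : ℝ) • (c * B - c * (c * B)) = B := by
    simp only [hB, jmul_sub, jmul_smul, h4]
    module
  have e1 : ⟪A, v⟫ = ⟪A, A⟫ := by
    conv_lhs => rw [← hAA]
    rw [inner_sub_left, real_inner_smul_left, hs, hs, hs, ← real_inner_smul_right, ← inner_sub_right]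
  have e2 : ⟪B, v⟫ = ⟪B, B⟫ := by
    conv_lhs => rw [← hBB]
    rw [real_inner_smul_left, inner_sub_left, hs, hs, hs, ← inner_sub_right, ← real_inner_smul_right]
  have e3 : c * v = A + (1 / 2 : ℝ) • B := by rw [hA, hB]; module
  rw [e3, inner_add_left, real_inner_smul_left, e1, e2]
  have := real_inner_self_nonneg (x := A)
  have := real_inner_self_nonneg (x := B)
  linarith

theorem IsIdempotentSystem.le_inner_fcalc {S : Finset ℝ} {c : ℝ → V} (h : IsIdempotentSystem S c)
    {f : ℝ → ℝ} {a : ℝ} (hf : ∀ μ ∈ S, a ≤ f μ) (v : V) :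
    a * ⟪v, v⟫ ≤ ⟪fcalc S c f * v, v⟫ := by
  have h1 : a * ⟪v, v⟫ = ∑ μ ∈ S, a * ⟪c μ * v, v⟫ := by
    rw [← Finset.mul_sum, ← sum_inner, ← sum_jmul, h.sum_eq, jone_mul]
  rw [h1, fcalc, sum_jmul, sum_inner]
  refine Finset.sum_le_sum fun μ hμ => ?_
  rw [smul_jmul, real_inner_smul_left]
  exact mul_le_mul_of_nonneg_right (hf μ hμ) (inner_idempotent_nonneg (h.idem μ hμ) v)

theorem IsIdempotentSystem.le_of_le_inner {S : Finset ℝ} {c : ℝ → V} (h : IsIdempotentSystem S c)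
    {f : ℝ → ℝ} {a : ℝ} (hf : ∀ v, a * ⟪v, v⟫ ≤ ⟪fcalc S c f * v, v⟫) {μ : ℝ} (hμ : μ ∈ S) :
    a ≤ f μ := by
  have h1 := hf (c μ)
  rw [h.fcalc_mul_apply f hμ, real_inner_smul_left] at h1
  exact le_of_mul_le_mul_right h1 (real_inner_self_pos.2 (h.ne_zero μ hμ))

theorem mem_range_sq_iff (y : V) :
    y ∈ Set.range (fun x : V => x * x) ↔ ∀ v : V, 0 ≤ ⟪y * v, v⟫ := by
  constructor
  · rintro ⟨x, rfl⟩ v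
    obtain ⟨S, c, h, rfl⟩ := exists_isIdempotentSystem x
    simp only [h.fcalc_mul]
    simpa using h.le_inner_fcalc (f := fun μ => id μ * id μ) (a := 0)
      (fun μ _ => mul_self_nonneg μ) v
  · intro hy
    obtain ⟨S, c, h, rfl⟩ := exists_isIdempotentSystem y
    refine ⟨fcalc S c Real.sqrt, ?_⟩
    simp only [h.fcalc_mul]
    refine Finset.sum_congr rfl fun μ hμ => ?_
    have : 0 ≤ id μ := h.le_of_le_inner (f := id) (by simpa using hy) hμ
    exact congrArg (· • c μ) (Real.mul_self_sqrt this)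

/-- The interior of {L(y) ≥ 0} is {L(y) > 0}. If y is interior, y - a e is still a square for some a
> 0; conversely a bound a > 0 survives perturbations of operator norm less than a. -/
theorem mem_cone_iff (y : V) :
    y ∈ cone V ↔ ∃ a : ℝ, 0 < a ∧ ∀ v : V, a * ⟪v, v⟫ ≤ ⟪y * v, v⟫ := by
  have hdef : y ∈ cone V ↔ y ∈ interior (Set.range fun x : V => x * x) := Iff.rfl
  rw [hdef, mem_interior_iff_mem_nhds]
  constructor
  · intro hy
    have hc : Filter.Tendsto (fun a : ℝ => y - a • (1 : V)) (nhdsWithin 0 (Set.Ioi 0)) (nhds y) := by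
      have : Continuous fun a : ℝ => y - a • (1 : V) := by fun_prop
      simpa using (this.tendsto 0).mono_left nhdsWithin_le_nhds
    obtain ⟨a, ha, ha0⟩ := ((hc.eventually hy).and self_mem_nhdsWithin).exists
    refine ⟨a, ha0, fun v => ?_⟩
    have := (mem_range_sq_iff _).1 ha v
    rw [mul_comm, jmul_sub, jmul_smul, jmul_one, mul_comm v, inner_sub_left,
      real_inner_smul_left] at this
    linarith
  · rintro ⟨a, ha, h⟩
    have hc : Continuous fun z : V => lmul (z - y) := by fun_prop
    have h0 : Filter.Tendsto (fun z : V => ‖lmul (z - y)‖) (nhds y) (nhds 0) := by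
      simpa using (hc.norm.tendsto y)
    filter_upwards [h0.eventually (gt_mem_nhds ha)] with z hz
    refine (mem_range_sq_iff z).2 fun v => ?_
    have h1 : ⟪z * v, v⟫ = ⟪y * v, v⟫ + ⟪lmul (z - y) v, v⟫ := by
      simp [← inner_add_left]
    have h2 : |⟪lmul (z - y) v, v⟫| ≤ a * ⟪v, v⟫ := by
      refine (abs_real_inner_le_norm _ _).trans ?_
      rw [real_inner_self_eq_norm_mul_norm, ← mul_assoc]
      gcongr
      exact (ContinuousLinearMap.le_opNorm _ _).trans (by gcongr)
    have h3 := h v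
    have h4 := neg_abs_le ⟪lmul (z - y) v, v⟫
    rw [h1]
    linarith

theorem IsIdempotentSystem.fcalc_mem_cone_iff {S : Finset ℝ} {c : ℝ → V}
    (h : IsIdempotentSystem S c) {f : ℝ → ℝ} : fcalc S c f ∈ cone V ↔ ∀ μ ∈ S, 0 < f μ := by
  rw [mem_cone_iff]
  constructor
  · rintro ⟨a, ha, hf⟩ μ hμ
    exact ha.trans_le (h.le_of_le_inner hf hμ)
  · intro hf
    rcases S.eq_empty_or_nonempty with rfl | hS
    · exact ⟨1, one_pos, h.le_inner_fcalc (by simp)⟩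
    · obtain ⟨ν, hν, hmin⟩ := S.exists_min_image f hS
      exact ⟨f ν, hf ν hν, h.le_inner_fcalc hmin⟩

theorem one_mem_cone : (1 : V) ∈ cone V :=
  (mem_cone_iff _).2 ⟨1, one_pos, fun v => by rw [jone_mul (V := V), _root_.one_mul]⟩

theorem add_mem_cone {x y : V} (hx : x ∈ cone V) (hy : y ∈ cone V) : x + y ∈ cone V := by
  obtain ⟨a, ha, h1⟩ := (mem_cone_iff x).1 hx
  obtain ⟨b, hb, h2⟩ := (mem_cone_iff y).1 hy
  refine (mem_cone_iff _).2 ⟨a + b, add_pos ha hb, fun v => ?_⟩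
  rw [add_jmul (V := V), inner_add_left, add_mul]
  exact add_le_add (h1 v) (h2 v)

theorem smul_mem_cone {t : ℝ} (ht : 0 < t) {x : V} (hx : x ∈ cone V) : t • x ∈ cone V := by
  obtain ⟨a, ha, h1⟩ := (mem_cone_iff x).1 hx
  refine (mem_cone_iff _).2 ⟨t * a, mul_pos ht ha, fun v => ?_⟩
  rw [smul_jmul, real_inner_smul_left, mul_assoc]
  exact mul_le_mul_of_nonneg_left (h1 v) ht.le

theorem smul_mem_cone_iff {t : ℝ} (ht : 0 < t) {x : V} : t • x ∈ cone V ↔ x ∈ cone V := by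
  refine ⟨fun h => ?_, smul_mem_cone ht⟩
  simpa [smul_smul, ht.ne'] using smul_mem_cone (inv_pos.2 ht) h

theorem inner_nonneg_of_mem_closure_cone {y : V} (hy : y ∈ closure (cone V : Set V)) (v : V) :
    0 ≤ ⟪y * v, v⟫ := by
  have hc : IsClosed {z : V | 0 ≤ ⟪lmul z v, v⟫} := by
    have : Continuous fun z : V => lmul z v := by fun_prop
    exact isClosed_le continuous_const (this.inner continuous_const)
  refine closure_minimal (fun z hz => ?_) hc hy
  exact (mem_range_sq_iff z).1 (interior_subset hz) v

end Spectral

section Exponential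

variable {V : Type*} [NormedAddCommGroup V] [InnerProductSpace ℝ V] [FiniteDimensional ℝ V]

/-! ### Exponentials of operators -/

theorem opExp_add_of_commute {A B : V →L[ℝ] V} (h : Commute A B) :
    NormedSpace.exp (A + B) = NormedSpace.exp A * NormedSpace.exp B := by
  let _ := NormedAlgebra.restrictScalars ℚ ℝ (V →L[ℝ] V)
  exact NormedSpace.exp_add_of_commute h

theorem opExp_apply_of_eigen {A : V →L[ℝ] V} {v : V} {μ : ℝ} (h : A v = μ • v) :
    NormedSpace.exp A v = Real.exp μ • v := by
  have hp : ∀ n : ℕ, (A ^ n) v = μ ^ n • v := by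
    intro n
    induction n with
    | zero => simp
    | succ n ih => rw [pow_succ, mulop_apply, h, map_smul, ih, smul_smul, pow_succ']
  have h1 := (NormedSpace.exp_series_hasSum_exp' (𝕂 := ℝ) A).mapL
    (ContinuousLinearMap.apply ℝ V v)
  have h2 := (NormedSpace.exp_series_hasSum_exp' (𝕂 := ℝ) μ).smul_const v
  rw [← Real.exp_eq_exp_ℝ] at h2
  refine h1.unique ?_
  convert h2 using 2 with n
  simp [hp, smul_smul]

theorem det_opExp {A : V →L[ℝ] V} (hA : (A : V →ₗ[ℝ] V).IsSymmetric) :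
    LinearMap.det (NormedSpace.exp A : V →L[ℝ] V).toLinearMap =
      Real.exp (LinearMap.trace ℝ V A.toLinearMap) := by
  set b := (hA.eigenvectorBasis rfl).toBasis with hb
  have h1 : ∀ i, A (b i) = hA.eigenvalues rfl i • b i := by
    intro i
    rw [hb, OrthonormalBasis.coe_toBasis]
    exact hA.apply_eigenvectorBasis rfl i
  have h2 : LinearMap.toMatrix b b (NormedSpace.exp A : V →L[ℝ] V).toLinearMap =
      Matrix.diagonal fun i => Real.exp (hA.eigenvalues rfl i) := by
    ext i j
    rw [LinearMap.toMatrix_apply, ContinuousLinearMap.coe_coe, opExp_apply_of_eigen (h1 j), map_smul,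
      Module.Basis.repr_self, Matrix.diagonal_apply]
    by_cases hij : i = j
    · simp [hij]
    · simp [hij]
  rw [← LinearMap.det_toMatrix b, h2, Matrix.det_diagonal,
    hA.trace_eq_sum_eigenvalues rfl]
  simp [Real.exp_sum]

/-! ### The quadratic representation along one-parameter groups -/

variable [CommMagma V] [One V] [IsSimpleEuclideanJordanAlgebra V]

/-- The quadratic representation as a continuous linear map. -/
def quadOp (x : V) : V →L[ℝ] V := (2 : ℝ) • (lmul x * lmul x) - lmul (x * x)

theorem quadOp_apply (x y : V) : quadOp x y = quadRep x y := rfl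

theorem quadOp_one : quadOp (1 : V) = 1 := by
  ext x
  simp only [quadOp_apply, quadRep, jone_mul, oneop_apply]
  module

theorem quadOp_apply_one (x : V) : quadOp x 1 = x * x := by
  simp only [quadOp_apply, quadRep, jmul_one]
  module

/-- The infinitesimal form of `quadOp_flow`: the right side is the derivative of P at z in the
direction xz. -/
theorem lmul_mul_quadOp_add (x z : V) :
    lmul x * quadOp z + quadOp z * lmul x =
      (2 : ℝ) • (lmul (x * z) * lmul z + lmul z * lmul (x * z) - lmul ((x * z) * z)) := by
  have h1 := lmul_triple x z z
  have h2 := lmul_linearized x z z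
  rw [mul_comm z x] at h2
  simp only [quadOp, mul_sub, sub_mul, mul_smul_comm, smul_mul_assoc, ← mul_assoc] at h1 h2 ⊢
  linear_combination (norm := module) (2 : ℝ) • h1 - h2

/-- The one-parameter group `exp (t L(x))`. -/
def flow (x : V) (t : ℝ) : V →L[ℝ] V := NormedSpace.exp (t • lmul x)

theorem hasDerivAt_flow (x : V) (t : ℝ) : HasDerivAt (flow x) (lmul x * flow x t) t :=
  hasDerivAt_exp_smul_const' (lmul x) t

theorem hasDerivAt_flow' (x : V) (t : ℝ) : HasDerivAt (flow x) (flow x t * lmul x) t :=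
  hasDerivAt_exp_smul_const (lmul x) t

theorem flow_zero (x : V) : flow x 0 = 1 := by simp [flow]

theorem flow_add (x : V) (s t : ℝ) : flow x (s + t) = flow x s * flow x t := by
  rw [flow, add_smul, opExp_add_of_commute (((Commute.refl _).smul_left s).smul_right t)]
  rfl

theorem flow_neg_mul (x : V) (t : ℝ) : flow x (-t) * flow x t = 1 := by
  rw [← flow_add, neg_add_cancel, flow_zero]

theorem flow_mul_neg (x : V) (t : ℝ) : flow x t * flow x (-t) = 1 := by
  rw [← flow_add, add_neg_cancel, flow_zero]

theorem flow_injective (x : V) (t : ℝ) : Function.Injective (flow x t) := by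
  intro u v h
  have := congrArg (flow x (-t)) h
  simpa only [← mulop_apply, flow_neg_mul, oneop_apply] using this

/-- Undoing the flow on both sides of P(exp(tL(x)) z) gives a function of t with zero derivative, by
`lmul_mul_quadOp_add`. -/
theorem quadOp_flow (x z : V) (t : ℝ) :
    quadOp (flow x t z) = flow x t * quadOp z * flow x t := by
  set F : ℝ → (V →L[ℝ] V) := fun t => flow x (-t) * quadOp (flow x t z) * flow x (-t) with hF
  have hd : ∀ t, HasDerivAt F 0 t := by
    intro t
    have h1 : HasDerivAt (fun t => flow x (-t)) (-(lmul x * flow x (-t))) t := by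
      exact ((hasDerivAt_flow x (-t)).scomp t (hasDerivAt_neg t)).congr_deriv (by module)
    have h1' : HasDerivAt (fun t => flow x (-t)) (-(flow x (-t) * lmul x)) t := by
      exact ((hasDerivAt_flow' x (-t)).scomp t (hasDerivAt_neg t)).congr_deriv (by module)
    have h2 : HasDerivAt (fun t => flow x t z) (x * flow x t z) t :=
      (hasDerivAt_flow x t).clm_apply (hasDerivAt_const t z) |>.congr_deriv (by
        simp)
    have h3 : HasDerivAt (fun t => lmul (flow x t z)) (lmul (x * flow x t z)) t :=
      (lmul (V := V)).hasFDerivAt.comp_hasDerivAt t h2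
    have h4 : HasDerivAt (fun t => lmul (flow x t z * flow x t z))
        (lmul ((x * flow x t z) * flow x t z + flow x t z * (x * flow x t z))) t :=
      (lmul (V := V)).hasFDerivAt.comp_hasDerivAt t
        (h3.clm_apply h2 |>.congr_deriv (by simp))
    have h5 : HasDerivAt (fun t => quadOp (flow x t z))
        (lmul x * quadOp (flow x t z) + quadOp (flow x t z) * lmul x) t := by
      rw [lmul_mul_quadOp_add]
      refine (((h3.mul h3).const_smul (2 : ℝ)).sub h4).congr_deriv ?_
      rw [mul_comm (flow x t z) (x * flow x t z), map_add]
      module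
    refine ((h1'.mul h5).mul h1).congr_deriv ?_
    simp only [Pi.mul_apply, mul_add, add_mul, neg_mul, mul_neg, mul_assoc]
    abel
  have hc : F t = F 0 := is_const_of_deriv_eq_zero (fun t => (hd t).differentiableAt)
    (fun t => (hd t).deriv) t 0
  simp only [hF, neg_zero, flow_zero, oneop_apply, mul_one, one_mul] at hc
  rw [← hc]
  simp only [← mul_assoc, flow_mul_neg, one_mul]
  rw [mul_assoc, flow_neg_mul, mul_one]

/-! ### The cone is invariant -/

/-- Each c_μ is an eigenvector of L(log w) with eigenvalue log μ, so exp(L(log w)) maps e = ∑ c_μ to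
w. -/
theorem IsIdempotentSystem.fcalc_eq_flow_log {S : Finset ℝ} {c : ℝ → V}
    (h : IsIdempotentSystem S c) (hpos : ∀ μ ∈ S, 0 < μ) :
    fcalc S c id = flow (fcalc S c Real.log) 1 1 := by
  conv_rhs => rw [← h.sum_eq, map_sum]
  refine Finset.sum_congr rfl fun μ hμ => ?_
  rw [flow, one_smul, opExp_apply_of_eigen (h.fcalc_mul_apply Real.log hμ),
    Real.exp_log (hpos μ hμ), id]

theorem exists_flow_of_mem_cone {w : V} (hw : w ∈ cone V) : ∃ x : V, w = flow x 1 1 := by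
  obtain ⟨S, c, h, rfl⟩ := exists_isIdempotentSystem w
  exact ⟨_, h.fcalc_eq_flow_log (h.fcalc_mem_cone_iff.1 hw)⟩

theorem quadOp_injective_of_mem_cone {y : V} (hy : y ∈ cone V) : Function.Injective (quadOp y) := by
  obtain ⟨x, rfl⟩ := exists_flow_of_mem_cone hy
  rw [quadOp_flow, quadOp_one, mul_one]
  exact (flow_injective x 1).comp (flow_injective x 1)

/-- At a boundary point some spectral value μ is 0, and P(y) c_μ = μ² c_μ then contradicts
injectivity. -/
theorem mem_cone_of_quadOp_injective {y : V} (hy : y ∈ closure (cone V : Set V))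
    (hi : Function.Injective (quadOp y)) : y ∈ cone V := by
  obtain ⟨S, c, h, rfl⟩ := exists_isIdempotentSystem y
  refine h.fcalc_mem_cone_iff.2 fun μ hμ => ?_
  have h0 : 0 ≤ id μ := h.le_of_le_inner (f := id)
    (by simpa using inner_nonneg_of_mem_closure_cone hy) hμ
  refine lt_of_le_of_ne h0 fun h1 => h.ne_zero μ hμ (hi ?_)
  rw [map_zero, quadOp_apply, quadRep, h.fcalc_mul, h.fcalc_mul_apply _ hμ, jmul_smul,
    h.fcalc_mul_apply _ hμ, h.fcalc_mul_apply _ hμ, ← h1]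
  simp

/-- Connectedness of ℝ: the times at which the orbit lies in Ω form an open set, and a closed one
because P stays injective along the whole orbit, which excludes boundary points. -/
theorem flow_mem_cone (x : V) (t : ℝ) {y : V} (hy : y ∈ cone V) : flow x t y ∈ cone V := by
  have hcont : Continuous fun s => flow x s y := by
    have : Continuous (flow x) :=
      continuous_iff_continuousAt.2 fun s => (hasDerivAt_flow x s).continuousAt
    fun_prop
  have hclopen : IsClopen {s | flow x s y ∈ cone V} := by
    refine ⟨?_, (cone V).isOpen.preimage hcont⟩
    rw [← closure_subset_iff_isClosed]
    intro s hs
    refine mem_cone_of_quadOp_injective (hcont.closure_preimage_subset _ hs) ?_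
    rw [quadOp_flow]
    exact ((flow_injective x s).comp (quadOp_injective_of_mem_cone hy)).comp (flow_injective x s)
  have := hclopen.eq_univ ⟨0, by simpa [flow_zero] using hy⟩
  exact this.ge (Set.mem_univ t)

theorem flow_mem_cone_iff (x : V) (t : ℝ) {y : V} : flow x t y ∈ cone V ↔ y ∈ cone V := by
  refine ⟨fun h => ?_, flow_mem_cone x t⟩
  have := flow_mem_cone x (-t) h
  rwa [← mulop_apply, flow_neg_mul, oneop_apply] at this

theorem quadOp_flow_one (x : V) (t : ℝ) : quadOp (flow x t 1) = flow x (2 * t) := by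
  rw [quadOp_flow, quadOp_one, mul_one, ← flow_add, two_mul]

theorem flow_one_mul_self (x : V) (t : ℝ) : flow x t 1 * flow x t 1 = flow x (2 * t) 1 := by
  rw [← quadOp_apply_one, quadOp_flow_one]

theorem det_flow (x : V) (t : ℝ) :
    LinearMap.det (flow x t).toLinearMap =
      Real.exp (t * LinearMap.trace ℝ V (lmul x).toLinearMap) := by
  have hs : ((t • lmul x : V →L[ℝ] V) : V →ₗ[ℝ] V).IsSymmetric := by
    rw [← map_smul]
    exact lmul_isSymmetric _
  rw [flow, det_opExp hs]
  simp

/-- These two properties are all that is used of the square root; uniqueness plays no role. -/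
theorem sqrt_spec {z : V} (hz : z ∈ cone V) : sqrt z ∈ cone V ∧ sqrt z * sqrt z = z := by
  obtain ⟨x, rfl⟩ := exists_flow_of_mem_cone hz
  have h : ∃ w ∈ (cone V : Set V), w * w = flow x 1 1 :=
    ⟨flow x (1 / 2) 1, flow_mem_cone x _ one_mem_cone, by rw [flow_one_mul_self]; norm_num⟩
  exact ⟨Function.invFunOn_mem h, Function.invFunOn_eq h⟩

end Exponential

section Determinant

variable {V : Type*} [NormedAddCommGroup V] [InnerProductSpace ℝ V] [FiniteDimensional ℝ V]
  [CommMagma V] [One V] [IsSimpleEuclideanJordanAlgebra V]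

/-! ### The trace form of the multiplication operators -/

/-- The linear form `x ↦ Tr L(x)`. -/
def traceL : V →ₗ[ℝ] ℝ :=
  LinearMap.trace ℝ V ∘ₗ ContinuousLinearMap.coeLM ℝ ∘ₗ (lmul (V := V)).toLinearMap

theorem traceL_apply (x : V) : traceL x = LinearMap.trace ℝ V (lmul x).toLinearMap := rfl

theorem traceL_assoc (x y w : V) : traceL ((x * y) * w) = traceL ((x * w) * y) := by
  have h := congrArg (fun T : V →L[ℝ] V => LinearMap.trace ℝ V T.toLinearMap) (lmul_assoc_sub x y w)
  simp only [ContinuousLinearMap.toLinearMap_sub, map_sub] at h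
  rw [traceL_apply, traceL_apply, ← sub_eq_zero, h, sub_eq_zero]
  exact LinearMap.trace_mul_comm ℝ (lmul x).toLinearMap
    (lmul y * lmul w - lmul w * lmul y : V →L[ℝ] V).toLinearMap

/-- By simplicity, the associative form `Tr L(xy)` is a multiple of the inner product. -/
theorem exists_traceL_eq : ∃ κ : ℝ, ∀ x : V, traceL x = κ * ⟪1, x⟫ := by
  have : Nontrivial V := IsSimpleEuclideanJordanAlgebra.toNontrivial
  set a : V := (InnerProductSpace.toDual ℝ V).symm (LinearMap.toContinuousLinearMap traceL) with ha
  have ha' : ∀ y, ⟪a, y⟫ = traceL y := fun y => by simp [ha]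
  -- The element a represents Tr L. Associativity of the trace form makes L(a) commute with every
  -- L(z), so its eigenspaces are ideals and simplicity makes L(a) scalar.
  have hcomm : ∀ y z : V, a * (z * y) = z * (a * y) := by
    intro y z
    refine ext_inner_right ℝ fun u => ?_
    rw [mul_comm a, inner_jmul, ha', inner_jmul z, mul_comm a, inner_jmul y, ha', mul_comm y]
    exact traceL_assoc z y u
  have hpos : 0 < Module.finrank ℝ V := Module.finrank_pos
  have hs := lmul_isSymmetric a
  set κ := hs.eigenvalues rfl ⟨0, hpos⟩ with hκ
  have he : Module.End.HasEigenvalue (lmul a).toLinearMap κ :=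
    hs.hasEigenvalue_eigenvalues rfl ⟨0, hpos⟩
  have hmem : ∀ y : V, y ∈ Module.End.eigenspace (lmul a).toLinearMap κ ↔ a * y = κ • y :=
    fun y => Module.End.mem_eigenspace_iff
  have htop : Module.End.eigenspace (lmul a).toLinearMap κ = ⊤ := by
    refine (IsSimpleEuclideanJordanAlgebra.simple _ fun x y hy => ?_).resolve_left he
    rw [hmem] at hy ⊢
    rw [hcomm, hy, jmul_smul]
  have h1 : a = κ • (1 : V) := by
    rw [← jmul_one a]
    exact (hmem 1).1 (htop ▸ Submodule.mem_top)
  refine ⟨κ, fun x => ?_⟩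
  rw [← ha', h1, real_inner_smul_left]

/-! ### The generic minimal polynomial at regular elements -/

theorem tr_eq_inner (x : V) : tr x = ⟪1, x⟫ := by
  rw [IsSimpleEuclideanJordanAlgebra.inner_eq_tr, jone_mul]

variable (V) in
-- Existence is forced by the normalization (x, y) = tr(xy): the default value 0 would give tr = 0
-- and hence a zero inner product on V ≠ 0.
theorem isGenericMinPoly_genericMinPoly : IsGenericMinPoly V (genericMinPoly V) := by
  have : Nontrivial V := IsSimpleEuclideanJordanAlgebra.toNontrivial
  by_cases h : ∃ q, IsGenericMinPoly V q
  · rw [genericMinPoly, dif_pos h]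
    exact h.choose_spec
  · obtain ⟨x, hx⟩ := exists_ne (0 : V)
    refine absurd ?_ hx
    rw [← inner_self_eq_zero (𝕜 := ℝ), IsSimpleEuclideanJordanAlgebra.inner_eq_tr, tr,
      genericMinPoly, dif_neg h]
    simp

/-- The generic minimal polynomial at `x`. -/
def charPoly (x : V) : Polynomial ℝ := (genericMinPoly V).map (MvPolynomial.eval (coord x))

theorem charPoly_monic (x : V) : (charPoly x).Monic :=
  (isGenericMinPoly_genericMinPoly V).1.map _

theorem charPoly_natDegree (x : V) : (charPoly x).natDegree = rank V := by
  rw [charPoly, (isGenericMinPoly_genericMinPoly V).1.natDegree_map]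
  exact (isGenericMinPoly_genericMinPoly V).2.1

namespace IsIdempotentSystem

variable {S : Finset ℝ} {c : ℝ → V} (h : IsIdempotentSystem S c)
include h

theorem charPoly_eval (f : ℝ → ℝ) {μ : ℝ} (hμ : μ ∈ S) : (charPoly (fcalc S c f)).eval (f μ) = 0 := by
  have h1 := (isGenericMinPoly_genericMinPoly V).2.2 (fcalc S c f)
  have h2 : fcalc S c (fun μ => (charPoly (fcalc S c f)).eval (f μ)) = 0 := by
    rw [← h1]
    simp only [h.jpow_fcalc, ← fcalc_smul]
    rw [fcalc]
    simp only [fcalc]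
    rw [Finset.sum_comm]
    refine Finset.sum_congr rfl fun μ _ => ?_
    rw [← Finset.sum_smul, Polynomial.eval_eq_sum_range, charPoly_natDegree]
    simp [charPoly]
  exact h.eq_zero_of_fcalc_eq_zero h2 hμ

/-- The elements of S are distinct roots of a monic polynomial of degree r. -/
theorem card_le_rank : S.card ≤ rank V := by
  by_contra! hlt
  refine (charPoly_monic (fcalc S c id)).ne_zero
    (Polynomial.eq_zero_of_degree_lt_of_eval_finset_eq_zero S ?_ fun μ hμ => h.charPoly_eval id hμ)
  rw [Polynomial.degree_eq_natDegree (charPoly_monic _).ne_zero, charPoly_natDegree]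
  exact_mod_cast hlt

/-- A monic polynomial of degree r is determined by r distinct roots; injectivity of f keeps them
distinct. -/
theorem charPoly_fcalc (hS : S.card = rank V) {f : ℝ → ℝ} (hf : Set.InjOn f S) :
    charPoly (fcalc S c f) = ∏ μ ∈ S, (Polynomial.X - Polynomial.C (f μ)) := by
  have hm := Polynomial.monic_prod_of_monic S _ fun μ _ => Polynomial.monic_X_sub_C (f μ)
  have hd : (∏ μ ∈ S, (Polynomial.X - Polynomial.C (f μ))).natDegree = rank V := by
    rw [Polynomial.natDegree_prod_of_monic _ _ fun μ _ => Polynomial.monic_X_sub_C (f μ)]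
    simp [hS]
  refine Polynomial.eq_of_degree_sub_lt_of_eval_index_eq S hf ?_ fun μ hμ => ?_
  · have hdeg : (charPoly (fcalc S c f)).degree = (rank V : ℕ) := by
      rw [Polynomial.degree_eq_natDegree (charPoly_monic _).ne_zero, charPoly_natDegree]
    rw [hS, ← hdeg]
    refine Polynomial.degree_sub_lt_left ?_ (charPoly_monic _).ne_zero ?_
    · rw [hdeg, Polynomial.degree_eq_natDegree hm.ne_zero, hd]
    · rw [(charPoly_monic _).leadingCoeff, hm.leadingCoeff]
  · rw [h.charPoly_eval f hμ, Polynomial.eval_prod, Finset.prod_eq_zero hμ (by simp)]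

theorem det_fcalc (hS : S.card = rank V) {f : ℝ → ℝ} (hf : Set.InjOn f S) :
    det (fcalc S c f) = ∏ μ ∈ S, f μ := by
  have h1 := congrArg (fun p : Polynomial ℝ => (-1) ^ rank V * p.coeff 0) (h.charPoly_fcalc hS hf)
  simp only [Polynomial.coeff_zero_prod, Polynomial.coeff_sub, Polynomial.coeff_X_zero,
    Polynomial.coeff_C_zero, zero_sub, Finset.prod_neg, hS, ← mul_assoc, ← mul_pow] at h1
  simpa [det, detPoly, charPoly] using h1

theorem card_pos : 0 < S.card := by
  have : Nontrivial V := IsSimpleEuclideanJordanAlgebra.toNontrivial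
  rw [Finset.card_pos, Finset.nonempty_iff_ne_empty]
  rintro rfl
  obtain ⟨x, hx⟩ := exists_ne (0 : V)
  have h1 := h.sum_eq
  rw [Finset.sum_empty] at h1
  exact hx (by rw [← jone_mul x, ← h1, zero_jmul])

theorem tr_fcalc (hS : S.card = rank V) {f : ℝ → ℝ} (hf : Set.InjOn f S) :
    tr (fcalc S c f) = ∑ μ ∈ S, f μ := by
  have h1 := congrArg (fun p : Polynomial ℝ => -p.coeff (rank V - 1)) (h.charPoly_fcalc hS hf)
  rw [← hS, Polynomial.prod_X_sub_C_coeff_card_pred _ _ h.card_pos, neg_neg, hS] at h1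
  simpa [tr, charPoly] using h1

open Classical in
theorem jpow_mem_span (f : ℝ → ℝ) (m : ℕ) :
    jpow (fcalc S c f) m ∈ Submodule.span ℝ ((S.image c : Finset V) : Set V) := by
  rw [h.jpow_fcalc]
  refine Submodule.sum_mem _ fun μ hμ => Submodule.smul_mem _ _ (Submodule.subset_span ?_)
  exact_mod_cast Finset.mem_image_of_mem c hμ

open Classical in
omit h in
theorem finrank_span_image_le : Module.finrank ℝ
    (Submodule.span ℝ ((S.image c : Finset V) : Set V)) ≤ S.card :=
  (finrank_span_finset_le_card _).trans Finset.card_image_le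

end IsIdempotentSystem

/-- `x` is regular if `e, x, …, xʳ⁻¹` are linearly independent. -/
def IsRegular (x : V) : Prop := LinearIndependent ℝ fun i : Fin (rank V) => jpow x i

open Classical in
theorem IsRegular.card_eq {S : Finset ℝ} {c : ℝ → V} (h : IsIdempotentSystem S c)
    (hx : IsRegular (fcalc S c id)) : S.card = rank V := by
  refine le_antisymm h.card_le_rank ?_
  have h1 := finrank_span_eq_card hx
  rw [Fintype.card_fin] at h1
  rw [← h1]
  refine (Submodule.finrank_mono (Submodule.span_le.2 ?_)).trans
    (IsIdempotentSystem.finrank_span_image_le (c := c))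
  rintro _ ⟨i, rfl⟩
  exact h.jpow_mem_span id i

open Classical in
theorem exists_isRegular : ∃ x : V, IsRegular x := by
  have hbdd : BddAbove (Set.range fun x : V =>
      Module.finrank ℝ (Submodule.span ℝ (Set.range (jpow x)))) :=
    ⟨Module.finrank ℝ V, by rintro _ ⟨x, rfl⟩; exact Submodule.finrank_le _⟩
  obtain ⟨x, hx⟩ := Nat.sSup_mem (Set.range_nonempty _) hbdd
  have hx' : Module.finrank ℝ (Submodule.span ℝ (Set.range (jpow x))) = rank V := hx
  obtain ⟨S, c, h, rfl⟩ := exists_isIdempotentSystem x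
  have hS : S.card = rank V := by
    refine le_antisymm h.card_le_rank ?_
    rw [← hx']
    refine (Submodule.finrank_mono (Submodule.span_le.2 ?_)).trans
      (IsIdempotentSystem.finrank_span_image_le (c := c))
    rintro _ ⟨i, rfl⟩
    exact h.jpow_mem_span id i
  refine ⟨fcalc S c id, Fintype.linearIndependent_iff.2 fun a ha => ?_⟩
  -- A linear relation among e, x, …, xʳ⁻¹ is a polynomial of degree less than r vanishing at the r
  -- points of S.
  set p : Polynomial ℝ := ∑ i : Fin (rank V), Polynomial.C (a i) * Polynomial.X ^ (i : ℕ) with hp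
  have hp0 : p = 0 := by
    refine Polynomial.eq_zero_of_degree_lt_of_eval_finset_eq_zero S ?_ fun μ hμ => ?_
    · rw [hS]
      exact Polynomial.degree_sum_fin_lt a
    · refine h.eq_zero_of_fcalc_eq_zero (f := fun μ => p.eval μ) ?_ hμ
      rw [← ha]
      simp only [h.jpow_fcalc, ← fcalc_smul]
      simp only [fcalc]
      rw [Finset.sum_comm]
      refine Finset.sum_congr rfl fun μ _ => ?_
      rw [← Finset.sum_smul]
      simp [hp, Polynomial.eval_finsetSum]
  intro i
  have := congrArg (fun q : Polynomial ℝ => q.coeff i) hp0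
  simpa [hp, Polynomial.finsetSum_coeff, Polynomial.coeff_X_pow, Fin.val_inj,
    Finset.sum_ite_eq] using this

theorem contDiff_jpow (m : ℕ) : ContDiff ℝ ω fun x : V => jpow x m := by
  induction m with
  | zero => exact contDiff_const
  | succ m ih =>
    have h1 : ContDiff ℝ ω fun x : V => lmul x := (lmul (V := V)).contDiff
    exact h1.clm_apply ih

/-- Regularity is the nonvanishing of an analytic function, the Gram determinant of e, x, …, xʳ⁻¹,
which is not identically zero. -/
theorem dense_isRegular : Dense {x : V | IsRegular x} := by
  set G : V → ℝ := fun x => (Matrix.gram ℝ fun i : Fin (rank V) => jpow x i).det with hG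
  have hGr : ∀ x, G x ≠ 0 ↔ IsRegular x := fun x => Matrix.det_gram_ne_zero_iff_linearIndependent
  have hGa : AnalyticOnNhd ℝ G Set.univ := by
    refine contDiff_omega_iff_analyticOnNhd.1 ?_
    simp only [hG, Matrix.det_apply]
    refine ContDiff.sum fun σ _ => ContDiff.const_smul _ (contDiff_prod fun i _ => ?_)
    exact (contDiff_jpow _).inner ℝ (contDiff_jpow _)
  intro x
  by_contra hx
  have h1 : G =ᶠ[nhds x] fun _ => 0 := by
    have := isClosed_closure.isOpen_compl.mem_nhds hx
    filter_upwards [this] with y hy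
    by_contra h0
    exact hy (subset_closure ((hGr y).1 h0))
  have h2 := hGa.eq_of_eventuallyEq (fun _ _ => analyticAt_const) h1
  obtain ⟨x0, hx0⟩ := exists_isRegular (V := V)
  exact (hGr x0).2 hx0 (congrFun h2 x0)

theorem rank_pos : 0 < rank V := by
  obtain ⟨x, hx⟩ := exists_isRegular (V := V)
  obtain ⟨S, c, h, rfl⟩ := exists_isIdempotentSystem x
  exact hx.card_eq h ▸ h.card_pos

/-- Adding e to a regular element shifts each of its r eigenvalues by 1; e itself need not be
regular. -/
theorem tr_one : tr (1 : V) = rank V := by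
  obtain ⟨x, hx⟩ := exists_isRegular (V := V)
  obtain ⟨S, c, h, rfl⟩ := exists_isIdempotentSystem x
  have hS := hx.card_eq h
  have h1 := h.tr_fcalc hS (f := id) Function.injective_id.injOn
  have h2 := h.tr_fcalc hS (f := fun μ => id μ + 1) (fun a _ b _ hab => by simpa using hab)
  rw [fcalc_add, h.fcalc_one, tr_eq_inner, inner_add_right, ← tr_eq_inner, ← tr_eq_inner, h1] at h2
  simpa [Finset.sum_add_distrib, hS] using h2

theorem traceL_eq (x : V) : traceL x = dim V / rank V * tr x := by
  obtain ⟨κ, hκ⟩ := exists_traceL_eq (V := V)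
  have h1 : traceL (1 : V) = dim V := by
    rw [traceL_apply, lmul_one]
    exact LinearMap.trace_one ℝ V
  have h2 := hκ 1
  rw [h1, ← tr_eq_inner, tr_one] at h2
  have hr : (rank V : ℝ) ≠ 0 := by exact_mod_cast rank_pos.ne'
  rw [hκ, ← tr_eq_inner, h2, mul_div_cancel_right₀ _ hr]

/-! ### The determinant on the cone -/

theorem continuous_coord : Continuous fun x : V => coord x :=
  continuous_pi fun _ => continuous_const.inner continuous_id

theorem continuous_det : Continuous (det : V → ℝ) :=
  (MvPolynomial.continuous_eval _).comp continuous_coord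

/-- For nonzero factors the identity holds at regular elements by the eigenvalue formula and extends
by density; the factor 0, which merges eigenvalues, follows by continuity in the scalar. -/
theorem det_smul (t : ℝ) (x : V) : det (t • x) = t ^ rank V * det x := by
  have hc : Continuous fun s : ℝ => det (s • x) := continuous_det.comp (by fun_prop)
  have key : ∀ s : ℝ, s ≠ 0 → det (s • x) = s ^ rank V * det x := by
    intro s hs
    have hcl : IsClosed {y : V | det (s • y) = s ^ rank V * det y} :=
      isClosed_eq (continuous_det.comp (by fun_prop)) (continuous_const.mul continuous_det)
    refine closure_minimal (fun y hy => ?_) hcl (dense_isRegular x)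
    obtain ⟨S, c, h, rfl⟩ := exists_isIdempotentSystem y
    have hS := IsRegular.card_eq h hy
    rw [Set.mem_ofPred_eq, ← fcalc_smul, h.det_fcalc hS (f := fun μ => s * id μ)
      (fun a _ b _ hab => by simpa [hs] using hab), h.det_fcalc hS Function.injective_id.injOn,
      Finset.prod_mul_distrib, Finset.prod_const, hS]
  have hcl : IsClosed {s : ℝ | det (s • x) = s ^ rank V * det x} :=
    isClosed_eq hc (by fun_prop)
  exact closure_minimal (fun s hs => key s hs) hcl (dense_compl_singleton (0 : ℝ) t)

theorem det_quadOp_flow (x : V) (t : ℝ) :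
    LinearMap.det (quadOp (flow x t 1)).toLinearMap = Real.exp (2 * t * traceL x) := by
  rw [quadOp_flow_one, det_flow, traceL_apply]

theorem continuous_det_quadOp :
    Continuous fun y : V => LinearMap.det (quadOp y).toLinearMap := by
  have h1 : Continuous fun y : V => lmul y := lmul.continuous
  have h2 : Continuous fun y : V => y * y := h1.clm_apply continuous_id
  have h3 : Continuous fun y : V => quadOp y :=
    ((h1.mul h1).const_smul (2 : ℝ)).sub (h1.comp h2)
  exact ContinuousLinearMap.continuous_det.comp h3

/-- For regular y = exp(L(log y)) e, Det P(y) = exp(2 Tr L(log y)) and det y = exp(tr log y).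
Integer powers make the relation a closed condition, so that it passes to all of Ω by density. -/
theorem det_quadOp_pow_of_mem_cone {y : V} (hy : y ∈ cone V) :
    0 ≤ det y ∧ LinearMap.det (quadOp y).toLinearMap ^ rank V = det y ^ (2 * dim V) := by
  have hcl : IsClosed {y : V | 0 ≤ det y ∧
      LinearMap.det (quadOp y).toLinearMap ^ rank V = det y ^ (2 * dim V)} :=
    (isClosed_le continuous_const continuous_det).inter
      (isClosed_eq (continuous_det_quadOp.pow _) (continuous_det.pow _))
  refine closure_minimal (fun z hz => ?_) hcl
    (dense_isRegular.open_subset_closure_inter (cone V).isOpen hy)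
  obtain ⟨hz, hreg⟩ := hz
  obtain ⟨S, c, h, rfl⟩ := exists_isIdempotentSystem z
  have hS := IsRegular.card_eq h hreg
  have hpos : ∀ μ ∈ S, 0 < μ := h.fcalc_mem_cone_iff.1 hz
  have hr : (rank V : ℝ) ≠ 0 := by exact_mod_cast rank_pos.ne'
  have h1 : det (fcalc S c id) = Real.exp (tr (fcalc S c Real.log)) := by
    rw [h.det_fcalc hS Function.injective_id.injOn, h.tr_fcalc hS
      (fun a ha b hb hab => Real.log_injOn_pos (hpos a ha) (hpos b hb) hab), Real.exp_sum]
    exact Finset.prod_congr rfl fun μ hμ => (Real.exp_log (hpos μ hμ)).symm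
  refine ⟨h1 ▸ (Real.exp_pos _).le, ?_⟩
  have h2 : fcalc S c id = flow (fcalc S c Real.log) 1 1 := h.fcalc_eq_flow_log hpos
  conv_lhs => rw [h2]
  rw [det_quadOp_flow, h1, traceL_eq, ← Real.exp_nat_mul, ← Real.exp_nat_mul]
  congr 1
  push_cast
  field_simp

theorem det_pos {y : V} (hy : y ∈ cone V) : 0 < det y := by
  obtain ⟨h0, h1⟩ := det_quadOp_pow_of_mem_cone hy
  refine lt_of_le_of_ne h0 fun h => ?_
  have hd : dim V ≠ 0 := by
    have : Nontrivial V := IsSimpleEuclideanJordanAlgebra.toNontrivial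
    exact Module.finrank_pos.ne'
  obtain ⟨x, rfl⟩ := exists_flow_of_mem_cone hy
  rw [← h, zero_pow (by omega), det_quadOp_flow] at h1
  exact (pow_pos (Real.exp_pos _) _).ne' h1

/-- `|Det P(z^{1/2})| = (det z)^{n/r}` on the cone. -/
theorem abs_det_quadOp_sqrt {z : V} (hz : z ∈ cone V) :
    |LinearMap.det (quadOp (sqrt z)).toLinearMap| = det z ^ ((dim V : ℝ) / (rank V : ℝ)) := by
  obtain ⟨hw, hwz⟩ := sqrt_spec hz
  have hdet := det_pos hz
  obtain ⟨-, h1⟩ := det_quadOp_pow_of_mem_cone hz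
  have hr : (rank V : ℝ) ≠ 0 := by exact_mod_cast rank_pos.ne'
  obtain ⟨x, hx⟩ := exists_flow_of_mem_cone hw
  -- With z^{1/2} = exp(L(x)) e one has P(z) = P(z^{1/2})², so the exponent 2n/r of det z is halved.
  have h2 : z = flow x 2 1 := by
    conv_lhs => rw [← hwz, hx, flow_one_mul_self]
    norm_num
  rw [hx, det_quadOp_flow, abs_of_pos (Real.exp_pos _), Real.rpow_def_of_pos hdet]
  have h3 := congrArg Real.log h1
  conv_lhs at h3 => rw [h2]
  rw [det_quadOp_flow, Real.log_pow, Real.log_pow, Real.log_exp] at h3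
  congr 1
  field_simp
  push_cast at h3
  linarith

theorem quadOp_sqrt_one {z : V} (hz : z ∈ cone V) : quadOp (sqrt z) 1 = z := by
  rw [quadOp_apply_one, (sqrt_spec hz).2]

theorem quadOp_sqrt_mem_cone_iff {z : V} (hz : z ∈ cone V) {v : V} :
    quadOp (sqrt z) v ∈ cone V ↔ v ∈ cone V := by
  obtain ⟨x, hx⟩ := exists_flow_of_mem_cone (sqrt_spec hz).1
  rw [hx, quadOp_flow_one, flow_mem_cone_iff]

end Determinant

/-! ### The complexified pairing -/

section Pairing

variable {V : Type*} [NormedAddCommGroup V] [InnerProductSpace ℝ V]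

theorem continuous_pairing (z : ℂ ⊗[ℝ] V) : Continuous fun ξ : V => pairing ξ z := by
  induction z using TensorProduct.induction_on with
  | zero => simpa using (continuous_const : Continuous fun _ : V => (0 : ℂ))
  | tmul a x =>
    simp only [pairing_tmul]
    have h : Continuous fun ξ : V => ⟪ξ, x⟫ := continuous_id.inner continuous_const
    exact h.smul continuous_const
  | add z w hz hw =>
    simp only [map_add]
    exact hz.add hw

theorem pairing_add_left (ξ η : V) (z : ℂ ⊗[ℝ] V) :
    pairing (ξ + η) z = pairing ξ z + pairing η z := by
  induction z using TensorProduct.induction_on with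
  | zero => simp
  | tmul a x => simp [inner_add_left, add_mul]
  | add z w hz hw => simp only [map_add, hz, hw]; ring

end Pairing

/-! ### Integration along the addition map -/

section PushSum

variable {V : Type*} [NormedAddCommGroup V] [InnerProductSpace ℝ V] [FiniteDimensional ℝ V]
  [MeasurableSpace V] [BorelSpace V]

/-- The density of the image of `h(x, y) dx dy` under `(x, y) ↦ x + y`. -/
def pushSum (h : V × V → ℂ) (ξ : V) : ℂ := ∫ x, h (x, ξ - x)

theorem pushSum_contDiff {h : V × V → ℂ} (hd : ContDiff ℝ ∞ h) (hc : HasCompactSupport h) :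
    ContDiff ℝ ∞ (pushSum h) := by
  set K : Set V := (fun q : V × V => -q.1) '' tsupport h with hK
  have hKc : IsCompact K := hc.isCompact.image (by fun_prop)
  set g : V → V → ℂ := fun ξ u => h (-u, ξ + u) with hg
  have hgs : ∀ p x, p ∈ (Set.univ : Set V) → x ∉ K → g p x = 0 := by
    intro p x _ hx
    by_contra h0
    exact hx ⟨(-x, p + x), subset_tsupport h h0, by simp⟩
  have hgd : ContDiffOn ℝ ∞ ↿g (Set.univ ×ˢ Set.univ) := by
    refine ContDiff.contDiffOn ?_
    have : ContDiff ℝ ∞ fun q : V × V => h (-q.2, q.1 + q.2) :=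
      hd.comp (contDiff_snd.neg.prodMk (contDiff_fst.add contDiff_snd))
    exact this
  -- The density is the convolution of the constant 1 with u ↦ h(-u, ξ + u), evaluated at 0, with ξ
  -- as a parameter.
  have key := contDiffOn_convolution_right_with_param_comp (μ := (volume : Measure V)) (n := ⊤)
    (ContinuousLinearMap.lsmul ℝ ℝ (E := ℂ)) (v := fun _ : V => (0 : V)) contDiffOn_const
    (f := fun _ : V => (1 : ℝ)) isOpen_univ hKc hgs
    (locallyIntegrable_const 1) hgd
  rw [contDiffOn_univ] at key
  convert key using 1
  ext ξ
  simp [pushSum, convolution, hg, sub_eq_add_neg]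

theorem support_pushSum_subset (h : V × V → ℂ) :
    Function.support (pushSum h) ⊆ (fun q : V × V => q.1 + q.2) '' tsupport h := by
  intro ξ hξ
  by_contra hn
  refine hξ ?_
  have : ∀ x, h (x, ξ - x) = 0 := by
    intro x
    by_contra h0
    exact hn ⟨(x, ξ - x), subset_tsupport h h0, by simp⟩
  simp [pushSum, this]

theorem tsupport_pushSum_subset {h : V × V → ℂ} (hc : HasCompactSupport h) :
    tsupport (pushSum h) ⊆ (fun q : V × V => q.1 + q.2) '' tsupport h :=
  closure_minimal (support_pushSum_subset h) (hc.isCompact.image (by fun_prop)).isClosed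

theorem pushSum_hasCompactSupport {h : V × V → ℂ} (hc : HasCompactSupport h) :
    HasCompactSupport (pushSum h) :=
  (hc.isCompact.image (by fun_prop : Continuous fun q : V × V => q.1 + q.2)).of_isClosed_subset
    (isClosed_tsupport _) (tsupport_pushSum_subset hc)

/-- Fubini combined with the measure-preserving shear (x, ξ) ↦ (x, ξ - x). -/
theorem integral_pushSum_mul {h : V × V → ℂ} (hh : Continuous h) (hc : HasCompactSupport h)
    {φ : V → ℂ} (hφ : Continuous φ) :
    ∫ ξ, pushSum h ξ * φ ξ = ∫ q : V × V, h q * φ (q.1 + q.2) := by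
  have hi : Integrable (fun q : V × V => h q * φ (q.1 + q.2)) (volume.prod volume) := by
    refine Continuous.integrable_of_hasCompactSupport (by fun_prop) hc.mul_right
  have hi2 : Integrable (fun q : V × V => h (q.1, q.2 - q.1) * φ q.2) (volume.prod volume) := by
    have := (measurePreserving_prod_neg_add (volume : Measure V) volume).integrable_comp_of_integrable hi
    refine this.congr (Filter.Eventually.of_forall fun q => ?_)
    simp [sub_eq_neg_add]
  rw [Measure.volume_eq_prod, integral_prod _ hi]
  have h1 : ∀ ξ, pushSum h ξ * φ ξ = ∫ x, h (x, ξ - x) * φ ξ := fun ξ => by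
    rw [pushSum, integral_mul_const]
  simp only [h1]
  rw [← integral_integral_swap (f := fun x ξ => h (x, ξ - x) * φ ξ) hi2]
  refine integral_congr_ae (Filter.Eventually.of_forall fun x => ?_)
  refine (integral_add_left_eq_self (fun ξ => h (x, ξ - x) * φ ξ) x).symm.trans ?_
  simp

end PushSum

/-! ### Polar-type coordinates -/

section Averaging

variable {V : Type*} [NormedAddCommGroup V] [InnerProductSpace ℝ V] [FiniteDimensional ℝ V]
  [MeasurableSpace V] [BorelSpace V] [CommMagma V] [One V] [IsSimpleEuclideanJordanAlgebra V]

theorem integral_comp_linear_eq {A : V →L[ℝ] V} (hA : LinearMap.det A.toLinearMap ≠ 0) {G : V → ℂ}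
    (hG : Continuous G) :
    ∫ u, G u = |LinearMap.det A.toLinearMap| * ∫ v, G (A v) := by
  have h1 := Measure.map_linearMap_addHaar_eq_smul_addHaar (volume : Measure V) hA
  have h2 : ∫ v, G (A v) = ∫ u, G u ∂(Measure.map A.toLinearMap volume) :=
    (integral_map A.continuous.aemeasurable hG.aestronglyMeasurable).symm
  rw [h2, h1, integral_smul_measure, ENNReal.toReal_ofReal (abs_nonneg _), Complex.real_smul,
    abs_inv, ← mul_assoc, ← Complex.ofReal_mul, mul_inv_cancel₀ (abs_ne_zero.2 hA)]
  simp

/-- P(ξ^{1/2}) maps e to ξ and preserves Ω in both directions, so ξ ± P(ξ^{1/2}) v lies in Ω exactly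
when e ± v does. -/
theorem support_iota {ξ v : V} (hξ : ξ ∈ cone V) (h : iota ξ v ∈ cone₂ V) : v ∈ interval V := by
  obtain ⟨h1, h2⟩ := h
  simp only [iota, SetLike.mem_coe] at h1 h2
  rw [smul_mem_cone_iff (by norm_num), ← quadOp_apply] at h1 h2
  have e1 := quadOp_sqrt_one hξ
  have h1' : quadOp (sqrt ξ) (1 - v) ∈ cone V := by rwa [map_sub, e1]
  have h2' : quadOp (sqrt ξ) (1 + v) ∈ cone V := by rwa [map_add, e1]
  exact ⟨(quadOp_sqrt_mem_cone_iff hξ).1 h2', (quadOp_sqrt_mem_cone_iff hξ).1 h1'⟩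

/-- The change of variables x = ξ/2 - A v with A = P(ξ^{1/2})/2. Off Ω both sides vanish because Ω +
Ω ⊆ Ω. -/
theorem averaging_eq_pushSum {h : V × V → ℂ} (hh : Continuous h)
    (hs : tsupport h ⊆ cone₂ V) : averaging h = pushSum h := by
  have hs0 : ∀ q, h q ≠ 0 → q ∈ cone₂ V := fun q hq => hs (subset_tsupport h hq)
  ext ξ
  by_cases hξ : ξ ∈ (cone V : Set V)
  · rw [averaging, Set.indicator_of_mem hξ]
    set A : V →L[ℝ] V := (1 / 2 : ℝ) • quadOp (sqrt ξ) with hA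
    have hdet : |LinearMap.det A.toLinearMap| =
        ((2 : ℝ) ^ dim V)⁻¹ * det ξ ^ ((dim V : ℝ) / (rank V : ℝ)) := by
      rw [hA, ContinuousLinearMap.toLinearMap_smul, LinearMap.det_smul, abs_mul,
        abs_det_quadOp_sqrt hξ, abs_of_pos (by positivity)]
      simp
    have hdet0 : LinearMap.det A.toLinearMap ≠ 0 := by
      rw [← abs_pos, hdet]
      have := det_pos hξ
      positivity
    rw [pushSum, ← integral_sub_left_eq_self (fun x => h (x, ξ - x)) volume ((1 / 2 : ℝ) • ξ),
      integral_comp_linear_eq hdet0 (G := fun u => h ((1 / 2 : ℝ) • ξ - u,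
        ξ - ((1 / 2 : ℝ) • ξ - u))) (by fun_prop), hdet]
    have hio : ∀ v, h ((1 / 2 : ℝ) • ξ - A v, ξ - ((1 / 2 : ℝ) • ξ - A v)) = h (iota ξ v) := by
      intro v
      congr 1
      ext <;> simp only [hA, iota, smul_apply, quadOp_apply] <;> module
    simp only [hio]
    rw [setIntegral_eq_integral_of_forall_compl_eq_zero]
    intro v hv
    by_contra h0
    exact hv (support_iota hξ (hs0 _ h0))
  · rw [averaging, Set.indicator_of_notMem hξ]
    by_contra h0
    obtain ⟨q, hq, rfl⟩ := support_pushSum_subset h (Ne.symm h0)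
    exact hξ (add_mem_cone (hs hq).1 (hs hq).2)

theorem tsupport_pushSum_subset_cone {h : V × V → ℂ} (hc : HasCompactSupport h)
    (hs : tsupport h ⊆ cone₂ V) : tsupport (pushSum h) ⊆ cone V := by
  refine (tsupport_pushSum_subset hc).trans ?_
  rintro _ ⟨q, hq, rfl⟩
  exact add_mem_cone (hs hq).1 (hs hq).2

/-! ### Laplace transforms -/

theorem laplace_eq_integral {g : V → ℂ} (hs : tsupport g ⊆ cone V) (z : ℂ ⊗[ℝ] V) :
    laplace g z = ∫ ξ, g ξ * Complex.exp (Complex.I * pairing ξ z) := by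
  refine setIntegral_eq_integral_of_forall_compl_eq_zero fun ξ hξ => ?_
  rw [image_eq_zero_of_notMem_tsupport fun h => hξ (hs h), zero_mul]

theorem laplace₂_eq_integral {h : V × V → ℂ} (hs : tsupport h ⊆ cone₂ V)
    (p : (ℂ ⊗[ℝ] V) × (ℂ ⊗[ℝ] V)) :
    laplace₂ h p = ∫ q, h q * Complex.exp (Complex.I * (pairing q.1 p.1 + pairing q.2 p.2)) := by
  refine setIntegral_eq_integral_of_forall_compl_eq_zero fun q hq => ?_
  rw [image_eq_zero_of_notMem_tsupport fun h => hq (hs h), zero_mul]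

theorem laplace_pushSum {h : V × V → ℂ} (hh : Continuous h) (hc : HasCompactSupport h)
    (hs : tsupport h ⊆ cone₂ V) (z : ℂ ⊗[ℝ] V) :
    laplace (pushSum h) z = laplace₂ h (z, z) := by
  have hp := continuous_pairing z
  rw [laplace_eq_integral (tsupport_pushSum_subset_cone hc hs), laplace₂_eq_integral hs,
    integral_pushSum_mul hh hc (by fun_prop)]
  simp only [pairing_add_left]

end Averaging

/-! ### Differential operators and the Laplace transform -/

section Differentiation

variable {V : Type*} [NormedAddCommGroup V] [InnerProductSpace ℝ V] [FiniteDimensional ℝ V]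

/-- The coordinates of `(x, y)`, as complex numbers. -/
def coordC (q : V × V) : Idx V → ℂ :=
  Sum.elim (fun j => (coord q.1 j : ℂ)) (fun j => (coord q.2 j : ℂ))

theorem evalPoly_eq (p : MvPolynomial (Idx V) ℂ) (q : V × V) :
    evalPoly p q = MvPolynomial.eval (coordC q) p := rfl

theorem contDiff_coordC (j : Idx V) : ContDiff ℝ ∞ fun q : V × V => coordC q j := by
  rcases j with j | j
  · exact Complex.ofRealCLM.contDiff.comp (contDiff_const.inner ℝ contDiff_fst)
  · exact Complex.ofRealCLM.contDiff.comp (contDiff_const.inner ℝ contDiff_snd)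

theorem contDiff_evalPoly (p : MvPolynomial (Idx V) ℂ) : ContDiff ℝ ∞ (evalPoly p) := by
  have : evalPoly p = fun q => ∑ d ∈ p.support, p.coeff d * ∏ i, coordC q i ^ d i := by
    ext q
    rw [evalPoly_eq, MvPolynomial.eval_eq']
  rw [this]
  exact ContDiff.sum fun d _ => contDiff_const.mul (contDiff_prod fun i _ =>
    (contDiff_coordC i).pow _)

/-- `(z, ξ) + (w, ζ)`. -/
def pairing₂ (q : V × V) (p : (ℂ ⊗[ℝ] V) × (ℂ ⊗[ℝ] V)) : ℂ := pairing q.1 p.1 + pairing q.2 p.2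

theorem pairing_smul (ξ : V) (a : ℂ) (z : ℂ ⊗[ℝ] V) : pairing ξ (a • z) = a * pairing ξ z := by
  induction z using TensorProduct.induction_on with
  | zero => simp
  | tmul b x => simp [TensorProduct.smul_tmul', mul_left_comm]
  | add z w hz hw => simp only [smul_add, map_add, hz, hw]; ring

theorem pairing₂_complexDir (q : V × V) (j : Idx V) : pairing₂ q (complexDir V j) = coordC q j := by
  rcases j with j | j <;> simp [pairing₂, complexDir, coordC, coord, real_inner_comm]

theorem pairing₂_add_smul (q : V × V) (p v : (ℂ ⊗[ℝ] V) × (ℂ ⊗[ℝ] V)) (t : ℂ) :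
    pairing₂ q (p + t • v) = pairing₂ q p + t * pairing₂ q v := by
  simp only [pairing₂, Prod.fst_add, Prod.snd_add, Prod.smul_fst, Prod.smul_snd, map_add,
    pairing_smul]
  ring

theorem continuous_pairing₂ (p : (ℂ ⊗[ℝ] V) × (ℂ ⊗[ℝ] V)) :
    Continuous fun q : V × V => pairing₂ q p :=
  ((continuous_pairing p.1).comp continuous_fst).add ((continuous_pairing p.2).comp continuous_snd)

variable [MeasurableSpace V] [BorelSpace V]

theorem lineDeriv_integral_exp {h : V × V → ℂ} (hh : Continuous h) (hc : HasCompactSupport h)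
    (p v : (ℂ ⊗[ℝ] V) × (ℂ ⊗[ℝ] V)) :
    lineDeriv ℂ (fun p => ∫ q, h q * Complex.exp (Complex.I * pairing₂ q p)) p v =
      ∫ q, (Complex.I * pairing₂ q v * h q) * Complex.exp (Complex.I * pairing₂ q p) := by
  have hp := continuous_pairing₂ p
  have hv := continuous_pairing₂ v
  set F : ℂ → V × V → ℂ := fun t q =>
    h q * Complex.exp (Complex.I * (pairing₂ q p + t * pairing₂ q v)) with hF
  set F' : ℂ → V × V → ℂ := fun t q =>
    (Complex.I * pairing₂ q v * h q) *
      Complex.exp (Complex.I * (pairing₂ q p + t * pairing₂ q v)) with hF'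
  -- A dominating function valid for complex |t| < 1.
  set bound : V × V → ℝ := fun q =>
    ‖h q‖ * (‖pairing₂ q v‖ * Real.exp (‖pairing₂ q p‖ + ‖pairing₂ q v‖)) with hb
  have hFc : ∀ t, Continuous (F t) := fun t => by simp only [hF]; fun_prop
  have hF'c : ∀ t, Continuous (F' t) := fun t => by simp only [hF']; fun_prop
  have key := (hasDerivAt_integral_of_dominated_loc_of_deriv_le (μ := (volume : Measure (V × V)))
    (F := F) (F' := F') (x₀ := (0 : ℂ)) (bound := bound) (Metric.ball_mem_nhds 0 one_pos)
    (Filter.Eventually.of_forall fun t => (hFc t).aestronglyMeasurable)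
    ((hFc 0).integrable_of_hasCompactSupport hc.mul_right)
    (hF'c 0).aestronglyMeasurable
    (Filter.Eventually.of_forall fun q t ht => ?_)
    (Continuous.integrable_of_hasCompactSupport (by fun_prop) hc.norm.mul_right)
    (Filter.Eventually.of_forall fun q t _ => ?_)).2
  · rw [lineDeriv]
    simp only [pairing₂_add_smul]
    rw [key.deriv]
    simp [hF']
  · rw [mem_ball_zero_iff] at ht
    have h1 : ‖Complex.I * (pairing₂ q p + t * pairing₂ q v)‖ ≤
        ‖pairing₂ q p‖ + ‖pairing₂ q v‖ := by
      rw [norm_mul, Complex.norm_I, one_mul]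
      refine (norm_add_le _ _).trans (add_le_add le_rfl ?_)
      rw [norm_mul]
      exact mul_le_of_le_one_left (norm_nonneg _) ht.le
    have h2 := (Complex.norm_exp_le_exp_norm (Complex.I * (pairing₂ q p + t * pairing₂ q v))).trans
      (Real.exp_le_exp.2 h1)
    simp only [hF', hb, norm_mul, Complex.norm_I, one_mul]
    calc ‖pairing₂ q v‖ * ‖h q‖ * ‖Complex.exp (Complex.I * (pairing₂ q p + t * pairing₂ q v))‖
        ≤ ‖pairing₂ q v‖ * ‖h q‖ * Real.exp (‖pairing₂ q p‖ + ‖pairing₂ q v‖) := by gcongr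
      _ = _ := by ring
  · have h1 : HasDerivAt (fun t : ℂ => Complex.I * (pairing₂ q p + t * pairing₂ q v))
        (Complex.I * pairing₂ q v) t := by
      simpa using (((hasDerivAt_id t).mul_const (pairing₂ q v)).const_add
        (pairing₂ q p)).const_mul Complex.I
    refine (h1.cexp.const_mul (h q)).congr_deriv ?_
    simp only [hF']
    ring

variable [CommMagma V] [One V] [IsSimpleEuclideanJordanAlgebra V]

theorem lineDeriv_laplace₂ {h : V × V → ℂ} (hh : Continuous h) (hc : HasCompactSupport h)
    (hs : tsupport h ⊆ cone₂ V) (j : Idx V) :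
    (fun p => lineDeriv ℂ (laplace₂ h) p (complexDir V j)) =
      laplace₂ fun q => Complex.I * coordC q j * h q := by
  ext p
  have h1 : laplace₂ h = fun p => ∫ q, h q * Complex.exp (Complex.I * pairing₂ q p) :=
    funext (laplace₂_eq_integral hs)
  rw [h1, lineDeriv_integral_exp hh hc,
    laplace₂_eq_integral ((tsupport_mul_subset_right (f := fun q => _)).trans hs)]
  simp only [pairing₂_complexDir]
  rfl

theorem continuous_coordC (j : Idx V) : Continuous fun q : V × V => coordC q j :=
  (contDiff_coordC j).continuous

theorem iterate_lineDeriv_laplace₂ {h : V × V → ℂ} (hh : Continuous h) (hc : HasCompactSupport h)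
    (hs : tsupport h ⊆ cone₂ V) (j : Idx V) (m : ℕ) :
    (fun (H : (ℂ ⊗[ℝ] V) × (ℂ ⊗[ℝ] V) → ℂ) p => lineDeriv ℂ H p (complexDir V j))^[m]
      (laplace₂ h) = laplace₂ fun q => (Complex.I * coordC q j) ^ m * h q := by
  induction m with
  | zero => simp
  | succ m ih =>
    have hcj := continuous_coordC (V := V) j
    rw [Function.iterate_succ_apply', ih, lineDeriv_laplace₂
      (h := fun q => (Complex.I * coordC q j) ^ m * h q) (by fun_prop) hc.mul_left
      ((tsupport_mul_subset_right (f := fun q => _)).trans hs)]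
    congr 1
    ext q
    ring

theorem iterPartial_laplace₂ {h : V × V → ℂ} (hh : Continuous h) (hc : HasCompactSupport h)
    (hs : tsupport h ⊆ cone₂ V) (m : Idx V →₀ ℕ) :
    iterPartial ℂ (complexDir V) m (laplace₂ h) =
      laplace₂ fun q => (∏ j, (Complex.I * coordC q j) ^ m j) * h q := by
  have key : ∀ l : List (Idx V),
      l.foldr (fun j G => (fun (H : (ℂ ⊗[ℝ] V) × (ℂ ⊗[ℝ] V) → ℂ) p =>
        lineDeriv ℂ H p (complexDir V j))^[m j] G) (laplace₂ h) =
      laplace₂ fun q => (l.map fun j => (Complex.I * coordC q j) ^ m j).prod * h q := by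
    intro l
    induction l with
    | nil => simp
    | cons j l ih =>
      have hcl : Continuous fun q : V × V =>
          (l.map fun j => (Complex.I * coordC q j) ^ m j).prod :=
        continuous_list_prod _ fun j _ => (continuous_const.mul (continuous_coordC j)).pow _
      rw [List.foldr_cons, ih, iterate_lineDeriv_laplace₂
        (h := fun q => (l.map fun j => (Complex.I * coordC q j) ^ m j).prod * h q)
        (by fun_prop) hc.mul_left
        ((tsupport_mul_subset_right (f := fun q => _)).trans hs)]
      congr 1
      ext q
      rw [List.map_cons, List.prod_cons, mul_assoc]
  rw [iterPartial, key]
  simp only [Finset.prod_map_toList]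

theorem diffOp_laplace₂ {h : V × V → ℂ} (hh : Continuous h) (hc : HasCompactSupport h)
    (hs : tsupport h ⊆ cone₂ V) (P : MvPolynomial (Idx V) ℂ)
    (p : (ℂ ⊗[ℝ] V) × (ℂ ⊗[ℝ] V)) :
    diffOp ℂ (complexDir V) P (laplace₂ h) p =
      laplace₂ (fun q => MvPolynomial.eval (fun j => Complex.I * coordC q j) P * h q) p := by
  have hsub : ∀ φ : V × V → ℂ, tsupport (fun q => φ q * h q) ⊆ cone₂ V := fun φ =>
    (tsupport_mul_subset_right (f := φ)).trans hs
  simp only [diffOp, iterPartial_laplace₂ hh hc hs, MvPolynomial.eval_eq']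
  simp only [laplace₂_eq_integral (hsub _)]
  have hp : Continuous fun q : V × V => pairing q.1 p.1 + pairing q.2 p.2 := continuous_pairing₂ p
  have hcj := continuous_coordC (V := V)
  simp only [← integral_const_mul]
  rw [← integral_finsetSum]
  · refine integral_congr_ae (Filter.Eventually.of_forall fun q => ?_)
    simp only [Finset.sum_mul, mul_assoc]
  · intro m _
    refine Continuous.integrable_of_hasCompactSupport (by fun_prop) ?_
    exact (hc.mul_left.mul_right).mul_left

end Differentiation

/-! ### Homogeneity -/

section Homogeneity

variable {V : Type*} [NormedAddCommGroup V] [InnerProductSpace ℝ V] [FiniteDimensional ℝ V]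
  [CommMagma V] [One V] [IsSimpleEuclideanJordanAlgebra V]

/-- `F` is homogeneous of degree `a` on `Ω × Ω`. -/
def HomogeneousOnCone (a : ℂ) (F : V × V → ℂ) : Prop :=
  ∀ t : ℝ, 0 < t → ∀ q ∈ cone₂ V, F (t • q) = (t : ℂ) ^ a * F q

theorem smul_mem_cone₂ {t : ℝ} (ht : 0 < t) {q : V × V} (hq : q ∈ cone₂ V) : t • q ∈ cone₂ V :=
  ⟨smul_mem_cone ht hq.1, smul_mem_cone ht hq.2⟩

/-- Openness of Ω × Ω gives the scaling relation along short segments. The rules for `deriv` under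
scaling hold even where the derivative takes its default value 0, so F may be arbitrary. -/
theorem HomogeneousOnCone.lineDeriv {a : ℂ} {F : V × V → ℂ} (hF : HomogeneousOnCone a F)
    (v : V × V) : HomogeneousOnCone (a - 1) fun q => lineDeriv ℝ F q v := by
  intro t ht q hq
  have htC : (t : ℂ) ≠ 0 := by exact_mod_cast ht.ne'
  have h1 : (fun s : ℝ => F (t • q + s • v)) =ᶠ[nhds 0]
      fun s => (t : ℂ) ^ a * F (q + (t⁻¹ * s) • v) := by
    have hcont : Continuous fun s : ℝ => q + (t⁻¹ * s) • v := by fun_prop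
    have hnhds := hcont.tendsto 0
    simp only [mul_zero, zero_smul, add_zero] at hnhds
    filter_upwards [hnhds.eventually ((cone₂ V).isOpen.mem_nhds hq)] with s hs
    rw [← hF t ht _ hs, smul_add, smul_smul, mul_inv_cancel_left₀ ht.ne']
  have h2 : deriv (fun s : ℝ => F (q + (t⁻¹ * s) • v)) 0 =
      t⁻¹ • deriv (fun s : ℝ => F (q + s • v)) 0 := by
    simpa using deriv_comp_mul_left t⁻¹ (fun s : ℝ => F (q + s • v)) 0
  simp only [_root_.lineDeriv]
  rw [h1.deriv_eq, deriv_const_mul_field, h2, Complex.cpow_sub _ _ htC, Complex.cpow_one,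
    Complex.real_smul]
  push_cast
  ring

theorem HomogeneousOnCone.iterPartial {a : ℂ} {F : V × V → ℂ} (hF : HomogeneousOnCone a F)
    (v : Idx V → V × V) (m : Idx V →₀ ℕ) :
    HomogeneousOnCone (a - m.degree) (iterPartial ℝ v m F) := by
  have key : ∀ l : List (Idx V), HomogeneousOnCone (a - ((l.map m).sum : ℕ))
      (l.foldr (fun j G => (fun (H : V × V → ℂ) z => _root_.lineDeriv ℝ H z (v j))^[m j] G) F) := by
    intro l
    induction l with
    | nil => simpa using hF
    | cons j l ih =>
      rw [List.foldr_cons, List.map_cons, List.sum_cons]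
      generalize m j = n
      induction n with
      | zero => simpa using ih
      | succ n ihn =>
        rw [Function.iterate_succ_apply']
        have := ihn.lineDeriv (v j)
        convert this using 1
        push_cast
        ring
  have := key Finset.univ.toList
  rwa [Finset.sum_map_toList, ← Finsupp.degree_eq_sum] at this

theorem HomogeneousOnCone.diffOp {a : ℂ} {F : V × V → ℂ} (hF : HomogeneousOnCone a F)
    (v : Idx V → V × V) {P : MvPolynomial (Idx V) ℂ} {d : ℕ} (hP : P.IsHomogeneous d) :
    HomogeneousOnCone (a - d) (diffOp ℝ v P F) := by
  intro t ht q hq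
  rw [RankinCohen.diffOp, RankinCohen.diffOp, Finset.mul_sum]
  refine Finset.sum_congr rfl fun m hm => ?_
  have hd : m.degree = d := by
    rw [Finsupp.degree_eq_weight_one]
    exact hP (MvPolynomial.mem_support_iff.1 hm)
  rw [hF.iterPartial v m t ht q hq, hd]
  ring

/-- Scaling by t = 2 suffices: comparing coefficients gives 2^{|d|} = 2^r for every exponent d in
the support. -/
theorem MvPolynomial_isHomogeneous_of_eval_smul {σ : Type*} {p : MvPolynomial σ ℝ} {r : ℕ}
    (h : ∀ (t : ℝ) (x : σ → ℝ), MvPolynomial.eval (t • x) p = t ^ r * MvPolynomial.eval x p) :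
    p.IsHomogeneous r := by
  intro d hd
  set p' : MvPolynomial σ ℝ := ∑ e ∈ p.support, MvPolynomial.monomial e (2 ^ e.degree * p.coeff e)
    with hp'
  have h1 : p' = MvPolynomial.C (2 ^ r) * p := by
    refine MvPolynomial.funext fun x => ?_
    rw [MvPolynomial.eval_mul, MvPolynomial.eval_C, ← h 2 x, hp', map_sum, MvPolynomial.eval_eq]
    refine Finset.sum_congr rfl fun e _ => ?_
    rw [MvPolynomial.eval_monomial, Finsupp.prod]
    simp only [Pi.smul_apply, smul_eq_mul, mul_pow, Finset.prod_mul_distrib]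
    rw [Finset.prod_pow_eq_pow_sum, Finsupp.degree_apply]
    ring
  have h2 := congrArg (MvPolynomial.coeff d) h1
  have h3 : p'.coeff d = 2 ^ d.degree * p.coeff d := by
    classical
    rw [hp', MvPolynomial.coeff_sum]
    simp only [MvPolynomial.coeff_monomial]
    rw [Finset.sum_ite_eq' p.support d, if_pos (MvPolynomial.mem_support_iff.2 hd)]
  rw [h3, MvPolynomial.coeff_C_mul] at h2
  have h4 := mul_right_cancel₀ hd h2
  rw [← show Finsupp.degree d = Finsupp.weight 1 d by rw [Finsupp.degree_eq_weight_one]; rfl]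
  exact pow_right_injective₀ two_pos (by norm_num) h4

theorem detPoly_isHomogeneous : (detPoly V).IsHomogeneous (rank V) := by
  refine MvPolynomial_isHomogeneous_of_eval_smul fun t x => ?_
  set v : V := (stdOrthonormalBasis ℝ V).repr.symm (WithLp.toLp 2 x) with hv
  have hx : coord v = x := by
    ext j
    rw [coord, ← OrthonormalBasis.repr_apply_apply, hv]
    simp
  have htx : coord (t • v) = t • x := by
    ext j
    rw [← hx]
    simp [coord, inner_smul_right]
  have := det_smul t v
  rwa [det, det, htx, hx] at this

theorem detSubPoly_pow_isHomogeneous (k : ℕ) :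
    (detSubPoly V ^ k).IsHomogeneous (rank V * k) := by
  refine MvPolynomial.IsHomogeneous.pow ?_ k
  have := (detPoly_isHomogeneous (V := V)).aeval
    (fun j => (MvPolynomial.X (Sum.inl j) - MvPolynomial.X (Sum.inr j) : MvPolynomial (Idx V) ℂ))
    (n := 1) fun j => (MvPolynomial.isHomogeneous_X _ _).sub (MvPolynomial.isHomogeneous_X _ _)
  rwa [one_mul] at this

theorem det_smul_cpow {t : ℝ} (ht : 0 < t) {x : V} (hx : x ∈ cone V) (a : ℂ) :
    (det (t • x) : ℂ) ^ a = (t : ℂ) ^ (rank V * a) * (det x : ℂ) ^ a := by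
  rw [det_smul, Complex.ofReal_mul, Complex.mul_cpow_ofReal_nonneg (by positivity) (det_pos hx).le,
    Complex.ofReal_pow, Complex.cpow_nat_mul']
  all_goals simp [Complex.arg_ofReal_of_nonneg ht.le, Real.pi_pos, Real.pi_pos.le]

theorem cFun_homogeneous (k : ℕ) (s t : ℂ) :
    HomogeneousOnCone ((rank V * k : ℕ) : ℂ) (cFun (V := V) k s t) := by
  intro τ hτ q hq
  have hτ0 : (τ : ℂ) ≠ 0 := by exact_mod_cast hτ.ne'
  have h1 : HomogeneousOnCone (rank V * (s + k) + rank V * (t + k))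
      (fun u : V × V => (det u.1 : ℂ) ^ (s + k) * (det u.2 : ℂ) ^ (t + k)) := by
    intro τ hτ q hq
    have hτ0 : (τ : ℂ) ≠ 0 := by exact_mod_cast hτ.ne'
    simp only [Prod.smul_fst, Prod.smul_snd]
    rw [det_smul_cpow hτ hq.1, det_smul_cpow hτ hq.2,
      Complex.cpow_add _ _ hτ0]
    ring
  have h2 := h1.diffOp (realDir V) (detSubPoly_pow_isHomogeneous k) τ hτ q hq
  -- Degree count: -rs - rt + r(s + k) + r(t + k) - rk = rk.
  have h3 : (τ : ℂ) ^ ((rank V * k : ℕ) : ℂ) = (τ : ℂ) ^ (rank V * -s) * (τ : ℂ) ^ (rank V * -t) *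
      (τ : ℂ) ^ (rank V * (s + k) + rank V * (t + k) - ((rank V * k : ℕ) : ℂ)) := by
    rw [← Complex.cpow_add _ _ hτ0, ← Complex.cpow_add _ _ hτ0]
    congr 1
    push_cast
    ring
  rw [cFun, cFun, h2, Prod.smul_fst, Prod.smul_snd, det_smul_cpow hτ hq.1, det_smul_cpow hτ hq.2, h3]
  ring

/-- Either `cPoly` agrees with `cFun` on Ω × Ω, or it has the default value 0; homogeneity holds in
both cases, and nothing else about `cPoly` is used later. -/
theorem cPoly_homogeneous (k : ℕ) (s t : ℂ) :
    HomogeneousOnCone ((rank V * k : ℕ) : ℂ) (evalPoly (cPoly V k s t)) := by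
  by_cases h : ∃ p : MvPolynomial (Idx V) ℂ, ∀ x ∈ cone V, ∀ y ∈ cone V,
      evalPoly p (x, y) = cFun k s t (x, y)
  · intro τ hτ q hq
    rw [cPoly, dif_pos h, h.choose_spec q.1 hq.1 q.2 hq.2]
    have hτq := smul_mem_cone₂ hτ hq
    rw [← cFun_homogeneous k s t τ hτ q hq]
    exact h.choose_spec _ hτq.1 _ hτq.2
  · intro τ hτ q hq
    rw [cPoly, dif_neg h]
    simp [evalPoly]

/-- Homogeneity is known only for real t > 0. The one-variable polynomials z ↦ P(z q) and z^d P(q)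
agree at these infinitely many points, hence also at z = i. -/
theorem HomogeneousOnCone.eval_I {P : MvPolynomial (Idx V) ℂ} {d : ℕ}
    (hP : HomogeneousOnCone (d : ℂ) (evalPoly P)) {q : V × V} (hq : q ∈ cone₂ V) :
    MvPolynomial.eval (fun j => Complex.I * coordC q j) P = Complex.I ^ d * evalPoly P q := by
  set Q : Polynomial ℂ :=
    MvPolynomial.aeval (fun j => Polynomial.X * Polynomial.C (coordC q j)) P with hQ
  have hev : ∀ z : ℂ, Q.eval z = MvPolynomial.eval (fun j => z * coordC q j) P := by
    intro z
    rw [hQ, MvPolynomial.aeval_eq_eval₂Hom, ← Polynomial.coe_evalRingHom, MvPolynomial.coe_eval₂Hom,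
      MvPolynomial.eval₂_eq', map_sum, MvPolynomial.eval_eq']
    refine Finset.sum_congr rfl fun d _ => ?_
    simp only [map_mul, map_prod, map_pow, Polynomial.coe_evalRingHom, Polynomial.eval_X,
      Polynomial.eval_C, Polynomial.algebraMap_eq]
  have heq : Q = Polynomial.C (evalPoly P q) * Polynomial.X ^ d := by
    refine Polynomial.eq_of_infinite_eval_eq _ _ ?_
    refine Set.Infinite.mono (s := (fun t : ℝ => (t : ℂ)) '' Set.Ioi 0) ?_
      ((Set.Ioi_infinite 0).image Complex.ofReal_injective.injOn)
    rintro _ ⟨t, ht, rfl⟩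
    have h1 := hP t ht q hq
    have h2 : coordC (t • q) = fun j => (t : ℂ) * coordC q j := by
      ext j
      rcases j with j | j <;> simp [coordC, coord, inner_smul_right]
    rw [evalPoly_eq, h2, Complex.cpow_natCast] at h1
    rw [Set.mem_ofPred_eq, hev, h1, Polynomial.eval_C_mul, Polynomial.eval_X_pow]
    ring
  rw [← hev, heq, Polynomial.eval_C_mul, Polynomial.eval_X_pow]
  ring

end Homogeneity

/-! ### Injectivity of the Laplace transform -/

section Uniqueness

variable {V : Type*} [NormedAddCommGroup V] [InnerProductSpace ℝ V] [FiniteDimensional ℝ V]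
  [MeasurableSpace V] [BorelSpace V]

open FourierTransform in
-- Each test function is the Fourier transform of a Schwartz function; moving the transform onto u
-- shows that u integrates to zero against it.
theorem ae_eq_zero_of_integral_exp_eq_zero {u : V → ℂ} (hu : Integrable u)
    (h : ∀ x : V, ∫ ξ, u ξ * Complex.exp (Complex.I * (⟪ξ, x⟫ : ℝ)) = 0) :
    ∀ᵐ ξ, u ξ = 0 := by
  refine ae_eq_zero_of_integral_contDiff_smul_eq_zero hu.locallyIntegrable fun φ hφ hφc => ?_
  have h1 : HasCompactSupport (Complex.ofRealCLM ∘ φ) := hφc.comp_left rfl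
  have h2 : ContDiff ℝ ∞ (Complex.ofRealCLM ∘ φ) := Complex.ofRealCLM.contDiff.comp hφ
  set Φ : SchwartzMap V ℂ := h1.toSchwartzMap h2 with hΦ
  set Ψ : SchwartzMap V ℂ := 𝓕⁻ Φ with hΨ
  have h3 : 𝓕 Ψ = Φ := FourierTransform.fourier_fourierInv_eq Φ
  have h4 : ∀ w : V, VectorFourier.fourierIntegral Real.fourierChar volume (innerₗ V) u w = 0 := by
    intro w
    rw [← h (-(2 * Real.pi) • w), VectorFourier.fourierIntegral]
    refine integral_congr_ae (Filter.Eventually.of_forall fun v => ?_)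
    simp only [innerₗ_apply_apply, Circle.smul_def, Real.fourierChar_apply, smul_eq_mul,
      inner_smul_right, mul_comm (u v)]
    congr 2
    push_cast
    ring
  have h5 := VectorFourier.integral_fourierIntegral_smul_eq_flip (L := innerₗ V) (μ := volume)
    (ν := volume) Real.continuous_fourierChar continuous_inner Ψ.integrable hu
  have hflip : (innerₗ V).flip = innerₗ V := by
    ext x y
    exact real_inner_comm _ _
  rw [hflip] at h5
  simp only [h4, smul_zero, integral_zero] at h5
  rw [← h5]
  refine integral_congr_ae (Filter.Eventually.of_forall fun v => ?_)
  have h6 : VectorFourier.fourierIntegral Real.fourierChar volume (innerₗ V) Ψ v = Φ v := by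
    rw [← h3, SchwartzMap.fourier_coe]
    rfl
  simp only [h6, hΦ]
  simp

variable [CommMagma V] [One V] [IsSimpleEuclideanJordanAlgebra V]

theorem ae_eq_of_laplace_eq {g₁ g₂ : V → ℂ}
    (h₁ : ∀ z ∈ tube V,
      IntegrableOn (fun ξ => g₁ ξ * Complex.exp (Complex.I * pairing ξ z)) (cone V))
    (h₂ : ∀ z ∈ tube V,
      IntegrableOn (fun ξ => g₂ ξ * Complex.exp (Complex.I * pairing ξ z)) (cone V))
    (h : ∀ z ∈ tube V, laplace g₁ z = laplace g₂ z) :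
    g₁ =ᵐ[volume.restrict (cone V : Set V)] g₂ := by
  have hmeas : MeasurableSet (cone V : Set V) := (cone V).isOpen.measurableSet
  -- On the slice x + ie the Laplace transform of g is a Fourier integral of the integrable function
  -- g(ξ) e^{-(e, ξ)}.
  set z : V → ℂ ⊗[ℝ] V := fun x => (1 : ℂ) ⊗ₜ[ℝ] x + Complex.I ⊗ₜ[ℝ] (1 : V) with hz
  have hzt : ∀ x, z x ∈ tube V := by
    intro x
    have : imPart (z x) = 1 := by simp [hz]
    change imPart (z x) ∈ cone V
    rw [this]
    exact one_mem_cone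
  have hzp : ∀ x ξ, Complex.I * pairing ξ (z x) =
      Complex.I * pairing ξ (z 0) + Complex.I * (⟪ξ, x⟫ : ℝ) := by
    intro x ξ
    simp only [hz, map_add, pairing_tmul, Complex.real_smul, inner_zero_right]
    push_cast
    ring
  set u : V → ℂ := (cone V : Set V).indicator fun ξ =>
    g₁ ξ * Complex.exp (Complex.I * pairing ξ (z 0)) -
      g₂ ξ * Complex.exp (Complex.I * pairing ξ (z 0)) with hu
  have hui : Integrable u :=
    (integrable_indicator_iff hmeas).2 ((h₁ _ (hzt 0)).sub (h₂ _ (hzt 0)))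
  have hu0 : ∀ x : V, ∫ ξ, u ξ * Complex.exp (Complex.I * (⟪ξ, x⟫ : ℝ)) = 0 := by
    intro x
    have e1 : ∀ ξ, u ξ * Complex.exp (Complex.I * (⟪ξ, x⟫ : ℝ)) =
        (cone V : Set V).indicator (fun ξ => g₁ ξ * Complex.exp (Complex.I * pairing ξ (z x)) -
          g₂ ξ * Complex.exp (Complex.I * pairing ξ (z x))) ξ := by
      intro ξ
      by_cases hξ : ξ ∈ (cone V : Set V)
      · rw [hu, Set.indicator_of_mem hξ, Set.indicator_of_mem hξ, hzp x, Complex.exp_add]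
        ring
      · rw [hu, Set.indicator_of_notMem hξ, Set.indicator_of_notMem hξ, zero_mul]
    simp only [e1]
    rw [integral_indicator hmeas, integral_sub (h₁ _ (hzt x)) (h₂ _ (hzt x)), sub_eq_zero]
    exact h _ (hzt x)
  rw [Filter.EventuallyEq, ae_restrict_iff' hmeas]
  filter_upwards [ae_eq_zero_of_integral_exp_eq_zero hui hu0] with ξ hξ hmem
  rw [hu, Set.indicator_of_mem hmem, ← sub_mul] at hξ
  exact sub_eq_zero.1 ((mul_eq_zero.1 hξ).resolve_right (Complex.exp_ne_zero _))

theorem integrableOn_laplace {g : V → ℂ} (hg : Continuous g) (hc : HasCompactSupport g)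
    (z : ℂ ⊗[ℝ] V) :
    IntegrableOn (fun ξ => g ξ * Complex.exp (Complex.I * pairing ξ z)) (cone V) := by
  have hp := continuous_pairing z
  exact (Continuous.integrable_of_hasCompactSupport (by fun_prop) hc.mul_right).integrableOn

/-! ### The inverse Laplace transform and the bracket -/

theorem testFunction_eq_of_laplace_eq (g₁ g₂ : 𝓓(cone V, ℂ))
    (h : ∀ z ∈ tube V, laplace g₁ z = laplace g₂ z) : g₁ = g₂ := by
  have hae := ae_eq_of_laplace_eq
    (fun z _ => integrableOn_laplace g₁.continuous g₁.hasCompactSupport z)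
    (fun z _ => integrableOn_laplace g₂.continuous g₂.hasCompactSupport z) h
  have heq := Measure.eqOn_open_of_ae_eq hae (cone V).isOpen g₁.continuous.continuousOn
    g₂.continuous.continuousOn
  ext ξ
  by_cases hξ : ξ ∈ (cone V : Set V)
  · exact heq hξ
  · rw [image_eq_zero_of_notMem_tsupport fun h => hξ (g₁.tsupport_subset h),
      image_eq_zero_of_notMem_tsupport fun h => hξ (g₂.tsupport_subset h)]

theorem laplaceInv_eq {F : ℂ ⊗[ℝ] V → ℂ} (g : 𝓓(cone V, ℂ))
    (h : ∀ z ∈ tube V, laplace g z = F z) : laplaceInv F = g := by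
  have hex : ∃ g : 𝓓(cone V, ℂ), ∀ z ∈ tube V, laplace g z = F z := ⟨g, h⟩
  rw [laplaceInv, dif_pos hex]
  exact congrArg _ (testFunction_eq_of_laplace_eq _ _ fun z hz => by rw [hex.choose_spec z hz, h z hz])

/-- The bracket of a Laplace transform. -/
theorem bracket_laplace₂ (k : ℕ) (lam mu : ℂ) (f : 𝓓(cone₂ V, ℂ)) (z : ℂ ⊗[ℝ] V) :
    bracket k lam mu (laplace₂ f) z = laplace₂ (fun q => Complex.I ^ (rank V * k) *
      (evalPoly (cPoly V k (lam - (dim V : ℂ) / (rank V : ℂ)) (mu - (dim V : ℂ) / (rank V : ℂ))) q *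
        f q)) (z, z) := by
  rw [bracket, diffOp_laplace₂ f.continuous f.hasCompactSupport f.tsupport_subset]
  congr 1
  ext q
  by_cases hq : q ∈ cone₂ V
  · rw [(cPoly_homogeneous k _ _).eval_I hq, mul_assoc]
  · rw [image_eq_zero_of_notMem_tsupport fun h => hq (f.tsupport_subset h)]
    simp

theorem averaging_const_mul (a : ℂ) (h : V × V → ℂ) :
    averaging (fun q => a * h q) = a • averaging h := by
  ext ξ
  by_cases hξ : ξ ∈ (cone V : Set V)
  · rw [Pi.smul_apply, averaging, averaging, Set.indicator_of_mem hξ, Set.indicator_of_mem hξ,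
      integral_const_mul, smul_eq_mul]
    ring
  · rw [Pi.smul_apply, averaging, averaging, Set.indicator_of_notMem hξ,
      Set.indicator_of_notMem hξ, smul_zero]

end Uniqueness

end RankinCohen

end

/-! ### The main theorem -/

theorem mainTheorem2 {V : Type*} [NormedAddCommGroup V] [InnerProductSpace ℝ V]
    [FiniteDimensional ℝ V] [MeasurableSpace V] [BorelSpace V] [CommMagma V] [One V]
    [RankinCohen.IsSimpleEuclideanJordanAlgebra V] (k : ℕ) (lam mu : ℂ)
    (f : 𝓓(RankinCohen.cone₂ V, ℂ)) :
    -- `B̂ f` is a function in `C_c^∞(Ω)` ...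
    (∃ g : 𝓓(RankinCohen.cone V, ℂ), RankinCohen.hatBracket k lam mu f = g) ∧
    -- ... with Laplace transform `B (ℒ₂ f)` on the tube domain ...
    (∀ z ∈ RankinCohen.tube V,
      RankinCohen.laplace (RankinCohen.hatBracket k lam mu f) z =
        RankinCohen.bracket k lam mu (RankinCohen.laplace₂ f) z) ∧
    -- ... which is unique among all functions with an absolutely convergent Laplace integral;
    (∀ g : V → ℂ,
      (∀ z ∈ RankinCohen.tube V,
        IntegrableOn (fun ξ => g ξ * Complex.exp (Complex.I * RankinCohen.pairing ξ z))
          (RankinCohen.cone V) ∧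
        RankinCohen.laplace g z =
          RankinCohen.bracket k lam mu (RankinCohen.laplace₂ f) z) →
      g =ᵐ[volume.restrict (RankinCohen.cone V : Set V)] RankinCohen.hatBracket k lam mu f) ∧
    -- and it is given by multiplication by the polynomial, followed by averaging.
    RankinCohen.hatBracket k lam mu f =
      Complex.I ^ (RankinCohen.rank V * k) • RankinCohen.averaging (fun q =>
        RankinCohen.evalPoly
          (RankinCohen.cPoly V k (lam - (RankinCohen.dim V : ℂ) / (RankinCohen.rank V : ℂ))
            (mu - (RankinCohen.dim V : ℂ) / (RankinCohen.rank V : ℂ))) q * f q) := by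
  set c := RankinCohen.cPoly V k (lam - (RankinCohen.dim V : ℂ) / (RankinCohen.rank V : ℂ))
    (mu - (RankinCohen.dim V : ℂ) / (RankinCohen.rank V : ℂ)) with hc
  set h : V × V → ℂ := fun q => Complex.I ^ (RankinCohen.rank V * k) *
    (RankinCohen.evalPoly c q * f q) with hh
  have hd : ContDiff ℝ ∞ h :=
    contDiff_const.mul ((RankinCohen.contDiff_evalPoly c).mul f.contDiff)
  have hcs : HasCompactSupport h := f.hasCompactSupport.mul_left.mul_left
  have hs : tsupport h ⊆ RankinCohen.cone₂ V :=
    ((tsupport_mul_subset_right (f := fun _ => _) (g := fun q => RankinCohen.evalPoly c q * f q)).trans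
      tsupport_mul_subset_right).trans f.tsupport_subset
  set g : 𝓓(RankinCohen.cone V, ℂ) := ⟨RankinCohen.pushSum h, RankinCohen.pushSum_contDiff hd hcs,
    RankinCohen.pushSum_hasCompactSupport hcs, RankinCohen.tsupport_pushSum_subset_cone hcs hs⟩
    with hg
  have hgc : (g : V → ℂ) = RankinCohen.pushSum h := rfl
  have hL : ∀ z, RankinCohen.laplace g z =
      RankinCohen.bracket k lam mu (RankinCohen.laplace₂ f) z := fun z => by
    rw [RankinCohen.bracket_laplace₂, hgc, RankinCohen.laplace_pushSum hd.continuous hcs hs]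
  have hB : RankinCohen.hatBracket k lam mu f = g := RankinCohen.laplaceInv_eq g fun z _ => hL z
  refine ⟨⟨g, hB⟩, fun z _ => by rw [hB, hL], fun g' hg' => ?_, ?_⟩
  · rw [hB]
    exact RankinCohen.ae_eq_of_laplace_eq (fun z hz => (hg' z hz).1)
      (fun z _ => RankinCohen.integrableOn_laplace g.continuous g.hasCompactSupport z)
      fun z hz => by rw [(hg' z hz).2, hL]
  · rw [hB, hgc, ← RankinCohen.averaging_const_mul, RankinCohen.averaging_eq_pushSum hd.continuous hs]
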